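/- Setting. Let $d,m\ge 1$, let $\Xi\subset\mathbb R^m$ be compact with $M_\Xi:=\max_{x\in\Xi}|x|$, let $\mu_0$ be a Borel probability measure on $\Xi$, let $p\in[1,\infty)$, $\eta_1,\eta_2>0$, and let $U:\mathbb R^d\times\Xi\to\mathbb R$ be continuously differentiable in $\theta$ for each $x$ and continuous in $x$ for each $\theta$. Assume that there are $L_\nabla>0$, $K_\nabla>1$, $J_U>0$ and $\nu,\chi\in\mathbb N_0$ such that for all $\theta,\theta_1,\theta_2\in\mathbb R^d$ and $x,x_1,x_2\in\Xi$, $$|\nabla_\theta U(\theta_1,x)-\nabla_\theta U(\theta_2,x)|\le L_\nabla(1+|x|)^\nu|\theta_1-\theta_2|,\qquad |\nabla_\theta U(\theta,x)|\le K_\nabla(1+|x|)^\nu,$$ $$|U(\theta,x_1)-U(\theta,x_2)|\le J_U(1+|\theta|)(1+|x_1|+|x_2|)^\chi|x_1-x_2|.$$ For a Borel set $A\subset\mathbb R^m$ let $\mathcal P(A)$ be the set of Borel probability measures on $A$, and let $d_c(\mu,\mu')=\inf_\zeta\int|x-x'|^p\,d\zeta(x,x')$, the infimum being over all couplings $\zeta$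 of $\mu$ and $\mu'$. Grid. Fix an integer $\ell\ge1$ with $\Xi\subset[-2^{\ell-1},2^{\ell-1})^m$. For an integer $j\ge1$ let $\mathbb K_{\ell,j}=\{-2^{\ell-1},-2^{\ell-1}+2^{-j},\dots,2^{\ell-1}-2^{-j}\}$, let $[x]_j=(\lfloor 2^jx_i\rfloor/2^j)_{i\le m}$, and let $\mu_{0,\ell,j}$ be the discrete measure giving each $c\in\mathbb K_{\ell,j}^m$ the mass $\mu_0\big(\Xi\cap\prod_i[c_i,c_i+2^{-j})\big)$. Put $$u(\theta)=\sup_{\mu\in\mathcal P(\Xi)}\Big(\int_\Xi U(\theta,x)\,d\mu(x)-\frac{d_c(\mu_0,\mu)^2}{2\eta_2}\Big)+\frac{\eta_1}2|\theta|^2,$$ $$u^{\ell,j}(\theta)=\sup_{\mu\in\mathcal P(\Xi\cap\mathbb K_{\ell,j}^m)}\Big(\int U(\theta,x)\,d\mu(x)-\frac{d_c(\mu_{0,\ell,j},\mu)^2}{2\eta_2}\Big)+\frac{\eta_1}2|\theta|^2 .$$ Algorithm. Let $\iota(\alpha)=\log\cosh\alpha$. Let $L_\iota$ be a Lipschitz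 constant of $\iota'$, $M_\iota$ a bound of $|\iota'|$, $\tilde L_\iota$ a Lipschitz constant of $\iota\iota'$, and let $a_\iota,b_\iota>0$ be such that $\alpha\,\iota(\alpha)\iota'(\alpha)\ge a_\iota\alpha^2-b_\iota$ for all $\alpha\in\mathbb R$ and $a_\iota\le b_\iota$ (for instance $a_\iota=\frac12$ and any $b_\iota\ge 4(\log 2)^2$). Let $\xi_1,\dots,\xi_N$ enumerate $\Xi\cap\mathbb K_{\ell,j}^m$ (repetitions allowed). For $\beta,\delta>0$, $\bar\theta=(\theta,\alpha)\in\mathbb R^d\times\mathbb R$ and $x\in\Xi$ let $F_k(\bar\theta,x)=\exp\big[\tfrac1\delta(U(\theta,\xi_k)-\iota(\alpha)|x-\xi_k|^p)\big]$ and $$H(\bar\theta,x)=\Big(\eta_1\theta+\frac{\sum_kF_k(\bar\theta,x)\nabla_\theta U(\theta,\xi_k)}{\sum_kF_k(\bar\theta,x)},\ \ \eta_2\iota(\alpha)\iota'(\alpha)-\frac{\sum_kF_k(\bar\theta,x)\,\iota'(\alpha)|x-\xi_k|^p}{\sum_kF_k(\bar\theta,x)}\Big).$$ On a probability space $(\Omega,\mathcal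 F,\mathbb P)$ let $(X_n)_{n\ge0}$ be i.i.d. with law $\mu_0$ and $(Z_n)_{n\ge0}$ i.i.d. with law $\mathcal N(0,I_{d+1})$, the two sequences being independent of each other, let $\bar\theta_0\in L^4(\mathbb P;\mathbb R^{d+1})$, and let $$\hat{\bar\theta}_0=\bar\theta_0,\qquad \hat{\bar\theta}_{n+1}=\hat{\bar\theta}_n-\lambda H(\hat{\bar\theta}_n,X_{n+1})+\sqrt{2\lambda\beta^{-1}}\,Z_{n+1}.$$ Let $\hat\theta_n$ denote the first $d$ components of $\hat{\bar\theta}_n$. Constants. Let $\tilde K_\nabla=\max\{K_\nabla,\max_{x\in\Xi}|U(0,x)|\}$, $a=\frac12\min\{\eta_1,\eta_2a_\iota\}$, $b=\eta_2b_\iota+\dfrac{2(K_\nabla(1+M_\Xi)^\nu+2^pM_\iota M_\Xi^p)^2}{\min\{\eta_1,\eta_2a_\iota\}}$, $$\mathfrak C_1=\frac{\min\{a,a^{1/3}\}}{16\sqrt{\mathbb E[(1+(1+|X_0|)^{2p})^4]}},$$ $$\mathfrak C_2=(8K_\nabla(1+M_\Xi)^\nu+2^{p+2}M_\iota\max\{1,M_\Xi^p\})(K_\nabla(1+M_\Xi)^\nu+2^{p-1}M_\iota\max\{1,M_\Xi^p\}),$$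 $$\mathfrak C_3=2L_\nabla(1+M_\Xi)^\nu+2^pL_\iota\max\{1,M_\Xi^p\}+\eta_1+\eta_2\tilde L_\iota+1,\qquad \lambda_{\max,\delta}=\min\Big\{\frac{\mathfrak C_1}{(\mathfrak C_2/\delta+\mathfrak C_3)^2},\frac1a\Big\},$$ $$\mathfrak M_1=(K_\nabla(1+M_\Xi)^\nu+2^pM_\iota M_\Xi+\eta_2\iota(0)\iota'(0))^2,\qquad \mathfrak c_{1,\delta,\beta}=2\mathfrak M_1\lambda_{\max,\delta}+2b+\frac{2(d+1)}\beta,$$ $$\mathfrak C_4=J_U(1+2M_\Xi)^\chi+\frac{8p\tilde K_\nabla}{\sqrt{\eta_2}}(1+4M_\Xi)^{\nu+p-1},$$ $$\tilde C_4=J_U(1+M_\Xi)^\chi+\frac{4p}{\sqrt{\eta_2}}(1+4M_\Xi)^{p-1}(1+2\tilde K_\nabla(1+M_\Xi)^\nu)+\frac{2^{p+2}pM_\Xi}{\eta_2}(1+4M_\Xi)^{p-1},$$ $$C_{5,\delta,\beta}=\mathfrak C_4\,\mathfrak c_{1,\delta,\beta}^{1/2}(\lambda_{\max,\delta}+a^{-1})^{1/2},\qquad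 C_6=\mathfrak C_4\big(\mathbb E|\bar\theta_0|^2\big)^{1/2}.$$ Claim. One has $\tilde C_4,C_{5,\delta,\beta}>0$ and $C_6\ge0$, with $C_6>0$ unless $\bar\theta_0=0$ almost surely. For every integer $j\ge1$ such that $[y]_j\in\Xi$ for all $y\in\Xi$, every $\lambda\in(0,\lambda_{\max,\delta})$ and every $n\ge1$, the random variables $u(\hat\theta_n)$ and $u^{\ell,j}(\hat\theta_n)$ are integrable and $$\Big|\mathbb E\big[u(\hat\theta_n)\big]-\mathbb E\big[u^{\ell,j}(\hat\theta_n)\big]\Big|\le\frac{\sqrt m\,\big(\tilde C_4+C_{5,\delta,\beta}+C_6e^{-a\lambda(n+1)}\big)}{2^j}.$$ -/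

import Mathlib

open MeasureTheory ProbabilityTheory

noncomputable section

namespace DRO

/-- The Euclidean space `ℝⁿ`. -/
abbrev Euc (n : ℕ) := EuclideanSpace ℝ (Fin n)

/-- `𝒫(A)`: Borel probability measures on `A`, seen as probability measures on the ambient
space that are concentrated on `A`. -/
def probOn {m : ℕ} (A : Set (Euc m)) : Set (Measure (Euc m)) :=
  {μ | IsProbabilityMeasure μ ∧ μ Aᶜ = 0}

/-- Couplings of `μ` and `μ'`. -/
def couplings {m : ℕ} (μ μ' : Measure (Euc m)) : Set (Measure (Euc m × Euc m)) :=
  {ζ | IsProbabilityMeasure ζ ∧ ζ.map Prod.fst = μ ∧ ζ.map Prod.snd = μ'}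

/-- The transport cost `d_c(μ, μ')` for the cost `c(x, x') = |x - x'|ᵖ`. -/
def transportCost {m : ℕ} (p : ℝ) (μ μ' : Measure (Euc m)) : ℝ :=
  sInf ((fun ζ : Measure (Euc m × Euc m) => ∫ z, ‖z.1 - z.2‖ ^ p ∂ζ) '' couplings μ μ')

/-- The data of the regularised distributionally robust problem. -/
structure Problem (d m : ℕ) where
  /-- the data space -/
  Ξ : Set (Euc m)
  /-- the reference measure -/
  μ₀ : Measure (Euc m)
  /-- the loss; only its values at `(θ, x)` with `x ∈ Ξ` matter -/
  U : Euc d → Euc m → ℝ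
  /-- the exponent of the cost -/
  p : ℝ
  /-- the regularisation parameter of `θ` -/
  η₁ : ℝ
  /-- the regularisation parameter of the transport cost -/
  η₂ : ℝ

/-- The robust objective on the data space `A` with reference measure `ρ`:
`sup_{μ ∈ 𝒫(A)} (∫_A U(θ,x) dμ(x) - d_c(ρ,μ)² / (2 η₂)) + (η₁/2) |θ|²`. -/
def robustObjective {d m : ℕ} (P : Problem d m) (A : Set (Euc m)) (ρ : Measure (Euc m))
    (θ : Euc d) : ℝ :=
  sSup ((fun μ : Measure (Euc m) =>
      (∫ x in A, P.U θ x ∂μ) - transportCost P.p ρ μ ^ 2 / (2 * P.η₂)) '' probOn A)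
    + P.η₁ / 2 * ‖θ‖ ^ 2

/-- The primal objective `u`. -/
def Problem.u {d m : ℕ} (P : Problem d m) (θ : Euc d) : ℝ :=
  robustObjective P P.Ξ P.μ₀ θ

/-! ### The dyadic grid -/

/-- `𝕂ᵐ` where `𝕂 = {-2^(ℓ-1), -2^(ℓ-1) + 2^(-j), …, 2^(ℓ-1) - 2^(-j)}`. -/
def dyadicGrid (m ℓ j : ℕ) : Set (Euc m) :=
  {x | ∀ i, ∃ k : ℕ, k < 2 ^ (ℓ + j) ∧ x i = -(2 : ℝ) ^ (ℓ - 1) + k / (2 : ℝ) ^ j}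

/-- The box `[-2^(ℓ-1), 2^(ℓ-1))ᵐ`. -/
def box (m ℓ : ℕ) : Set (Euc m) :=
  {x | ∀ i, -(2 : ℝ) ^ (ℓ - 1) ≤ x i ∧ x i < (2 : ℝ) ^ (ℓ - 1)}

/-- The cell `Q_{c,j} = ∏ᵢ [cᵢ, cᵢ + 2^(-j))`. -/
def cell {m : ℕ} (j : ℕ) (c : Euc m) : Set (Euc m) :=
  {x | ∀ i, c i ≤ x i ∧ x i < c i + 1 / (2 : ℝ) ^ j}

/-- The rounding map `[x]_j = (⌊2ʲ xᵢ⌋ / 2ʲ)ᵢ`. -/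
def dyadicFloor {m : ℕ} (j : ℕ) (x : Euc m) : Euc m :=
  WithLp.toLp 2 fun i => (⌊(2 : ℝ) ^ j * x i⌋ : ℝ) / (2 : ℝ) ^ j

/-- The discretised reference measure `μ_{0,ℓ,j}`, as the image of `μ₀` under `[·]_j`; the lemma
`gridMeasure_singleton` says that it gives each grid point the mass that `μ₀` gives its cell. -/
def gridMeasure {m : ℕ} (j : ℕ) (μ₀ : Measure (Euc m)) : Measure (Euc m) :=
  μ₀.map (dyadicFloor j)

theorem measurable_dyadicFloor {m : ℕ} (j : ℕ) :
    Measurable (dyadicFloor j : Euc m → Euc m) := by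
  unfold dyadicFloor
  refine (WithLp.measurable_toLp 2 _).comp (measurable_pi_lambda _ fun i => ?_)
  have h : Measurable fun x : Euc m => (2 : ℝ) ^ j * x i := by fun_prop
  exact ((measurable_from_top (f := fun k : ℤ => (k : ℝ))).comp
    (Int.measurable_floor.comp h)).div_const _

theorem gridMeasure_singleton {m ℓ : ℕ} (j : ℕ) (μ₀ : Measure (Euc m)) {c : Euc m}
    (hc : c ∈ dyadicGrid m ℓ j) : gridMeasure j μ₀ {c} = μ₀ (cell j c) := by
  rw [gridMeasure, Measure.map_apply (measurable_dyadicFloor j) (measurableSet_singleton c)]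
  congr 1
  ext x
  have h2 : (0 : ℝ) < 2 ^ j := by positivity
  have key : ∀ i, (⌊(2 : ℝ) ^ j * x i⌋ : ℝ) / (2 : ℝ) ^ j = c i ↔
      c i ≤ x i ∧ x i < c i + 1 / (2 : ℝ) ^ j := by
    intro i
    obtain ⟨k, -, hk⟩ := hc i
    obtain ⟨z, hz⟩ : ∃ z : ℤ, c i = z / (2 : ℝ) ^ j := by
      refine ⟨-(2 ^ (ℓ - 1) * 2 ^ j) + k, ?_⟩
      rw [hk]; push_cast; field_simp
    rw [hz, div_left_inj' h2.ne', Int.cast_inj, Int.floor_eq_iff, ← add_div, div_le_iff₀ h2,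
      lt_div_iff₀ h2, mul_comm]
  constructor
  · intro h i
    have h' : dyadicFloor j x = c := h
    exact (key i).1 (by rw [← h']; rfl)
  · intro h
    change dyadicFloor j x = c
    ext i
    exact (key i).2 (h i)

/-- The discretised primal objective `u^{ℓ,j}` on the data space `Ξ ∩ 𝕂ᵐ`. -/
def Problem.uGrid {d m : ℕ} (P : Problem d m) (ℓ j : ℕ) (θ : Euc d) : ℝ :=
  robustObjective P (P.Ξ ∩ dyadicGrid m ℓ j) (gridMeasure j P.μ₀) θ

/-! ### The assumptions -/

/-- The constants named in the assumptions on `U` and in the properties of `ι`. -/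
structure Consts where
  /-- the Lipschitz constant `L_∇` -/
  Lgrad : ℝ
  /-- the bound `K_∇` -/
  Kgrad : ℝ
  /-- the growth exponent of `∇U` -/
  ν : ℕ
  /-- the constant `J_U` -/
  J : ℝ
  /-- the growth exponent of the Lipschitz constant of `U` in `x` -/
  χ : ℕ
  /-- a Lipschitz constant of `ι'` -/
  Lι : ℝ
  /-- a bound of `ι'` -/
  Mι : ℝ
  /-- a Lipschitz constant of `ι ι'` -/
  Lιι : ℝ
  /-- the leading dissipativity constant of `ι ι'` -/
  aι : ℝ
  /-- the additive dissipativity constant of `ι ι'` -/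
  bι : ℝ

/-- `U` is `C¹` in `θ` and continuous in `x`. -/
def Problem.Regular {d m : ℕ} (P : Problem d m) : Prop :=
  (∀ x ∈ P.Ξ, ContDiff ℝ 1 fun θ => P.U θ x) ∧ ∀ θ, ContinuousOn (P.U θ) P.Ξ

/-- `∇_θ U(θ, x)`. -/
def Problem.gradU {d m : ℕ} (P : Problem d m) (θ : Euc d) (x : Euc m) : Euc d :=
  gradient (fun θ' => P.U θ' x) θ

/-- `∇_θ U` is Lipschitz in `θ` and bounded, with polynomial weights in `x`. -/
def Problem.GradientBounds {d m : ℕ} (P : Problem d m) (C : Consts) : Prop :=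
  0 < C.Lgrad ∧ 1 < C.Kgrad ∧
  (∀ θ₁ θ₂, ∀ x ∈ P.Ξ,
    ‖P.gradU θ₁ x - P.gradU θ₂ x‖ ≤ C.Lgrad * (1 + ‖x‖) ^ C.ν * ‖θ₁ - θ₂‖) ∧
  ∀ θ, ∀ x ∈ P.Ξ, ‖P.gradU θ x‖ ≤ C.Kgrad * (1 + ‖x‖) ^ C.ν

/-- `U` is locally Lipschitz in `x`. -/
def Problem.LipschitzInData {d m : ℕ} (P : Problem d m) (C : Consts) : Prop :=
  0 < C.J ∧ ∀ θ, ∀ x₁ ∈ P.Ξ, ∀ x₂ ∈ P.Ξ,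
    |P.U θ x₁ - P.U θ x₂| ≤ C.J * (1 + ‖θ‖) * (1 + ‖x₁‖ + ‖x₂‖) ^ C.χ * ‖x₁ - x₂‖

/-- `ι(α) = log cosh α`. -/
def iota (α : ℝ) : ℝ := Real.log (Real.cosh α)

/-- The constants of `C` are admissible for `ι`: bounds and Lipschitz constants of `ι'` and `ι ι'`,
and the dissipativity `α ι(α) ι'(α) ≥ a_ι α² - b_ι`. -/
def IotaConsts (C : Consts) : Prop :=
  (∀ α₁ α₂, |deriv iota α₁ - deriv iota α₂| ≤ C.Lι * |α₁ - α₂|) ∧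
  (∀ α, |deriv iota α| ≤ C.Mι) ∧
  (∀ α₁ α₂, |iota α₁ * deriv iota α₁ - iota α₂ * deriv iota α₂| ≤ C.Lιι * |α₁ - α₂|) ∧
  0 < C.aι ∧ 0 < C.bι ∧
  ∀ α, C.aι * α ^ 2 - C.bι ≤ α * iota α * deriv iota α

/-! ### The algorithm -/

/-- The first `d` components `θ` of `θ̄ = (θ, α)`. -/
def thetaPart {d : ℕ} (z : Euc (d + 1)) : Euc d := WithLp.toLp 2 fun i => z (Fin.castSucc i)

/-- The last component `α` of `θ̄ = (θ, α)`. -/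
def alphaPart {d : ℕ} (z : Euc (d + 1)) : ℝ := z (Fin.last d)

/-- The weight `F_k(θ̄, x) = exp ((U(θ, ξ_k) - ι(α) |x - ξ_k|ᵖ) / δ)`. -/
def gibbsWeight {d m N : ℕ} (P : Problem d m) (δ : ℝ) (ξ : Fin N → Euc m) (z : Euc (d + 1))
    (x : Euc m) (k : Fin N) : ℝ :=
  Real.exp (1 / δ *
    (P.U (thetaPart z) (ξ k) - iota (alphaPart z) * ‖x - ξ k‖ ^ P.p))

/-- The stochastic gradient `H(θ̄, x)`. -/
def stochGrad {d m N : ℕ} (P : Problem d m) (δ : ℝ) (ξ : Fin N → Euc m) (z : Euc (d + 1))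
    (x : Euc m) : Euc (d + 1) :=
  WithLp.toLp 2 (Fin.snoc (α := fun _ => ℝ)
    (P.η₁ • thetaPart z + (∑ k, gibbsWeight P δ ξ z x k)⁻¹ •
        ∑ k, gibbsWeight P δ ξ z x k • P.gradU (thetaPart z) (ξ k) : Euc d)
    (P.η₂ * iota (alphaPart z) * deriv iota (alphaPart z) -
      (∑ k, gibbsWeight P δ ξ z x k * (deriv iota (alphaPart z) * ‖x - ξ k‖ ^ P.p)) /
        ∑ k, gibbsWeight P δ ξ z x k))

/-- The robust SGLD iterates
`θ̄_{n+1} = θ̄_n - lam H(θ̄_n, X_{n+1}) + √(2 lam / β) Z_{n+1}` started at `θ̄₀`. -/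
def sgld {Ω : Type*} {d m N : ℕ} (P : Problem d m) (δ β lam : ℝ) (ξ : Fin N → Euc m)
    (θ₀ : Ω → Euc (d + 1)) (X : ℕ → Ω → Euc m) (Z : ℕ → Ω → Euc (d + 1)) :
    ℕ → Ω → Euc (d + 1)
  | 0 => θ₀
  | n + 1 => fun ω =>
      sgld P δ β lam ξ θ₀ X Z n ω
        - lam • stochGrad P δ ξ (sgld P δ β lam ξ θ₀ X Z n ω) (X (n + 1) ω)
        + Real.sqrt (2 * lam * β⁻¹) • Z (n + 1) ω

/-! ### The explicit constants -/

/-- `M_Ξ = max_{x ∈ Ξ} |x|`. -/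
def Problem.M {d m : ℕ} (P : Problem d m) : ℝ := sSup ((fun x => ‖x‖) '' P.Ξ)

/-- `K̃_∇ = max {K_∇, max_{x ∈ Ξ} |U(0, x)|}`. -/
def Ktilde {d m : ℕ} (P : Problem d m) (C : Consts) : ℝ :=
  max C.Kgrad (sSup ((fun x => |P.U 0 x|) '' P.Ξ))

/-- `a = min {η₁, η₂ a_ι} / 2`. -/
def constA {d m : ℕ} (P : Problem d m) (C : Consts) : ℝ := min P.η₁ (P.η₂ * C.aι) / 2

/-- `b = η₂ b_ι + 2 (K_∇ (1+M)^ν + 2ᵖ M_ι Mᵖ)² / min {η₁, η₂ a_ι}`. -/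
def constB {d m : ℕ} (P : Problem d m) (C : Consts) : ℝ :=
  P.η₂ * C.bι + 2 * (C.Kgrad * (1 + P.M) ^ C.ν + 2 ^ P.p * C.Mι * P.M ^ P.p) ^ 2
    / min P.η₁ (P.η₂ * C.aι)

/-- `ℭ₁ = min {a, a^(1/3)} / (16 √(E[(1 + (1+|X₀|)^(2p))⁴]))`, the law of `X₀` being `μ₀`. -/
def constFrak1 {d m : ℕ} (P : Problem d m) (C : Consts) : ℝ :=
  min (constA P C) (constA P C ^ (1 / 3 : ℝ)) /
    (16 * Real.sqrt (∫ x, (1 + (1 + ‖x‖) ^ (2 * P.p)) ^ 4 ∂P.μ₀))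

/-- `ℭ₂`. -/
def constFrak2 {d m : ℕ} (P : Problem d m) (C : Consts) : ℝ :=
  (8 * C.Kgrad * (1 + P.M) ^ C.ν + 2 ^ (P.p + 2) * C.Mι * max 1 (P.M ^ P.p)) *
    (C.Kgrad * (1 + P.M) ^ C.ν + 2 ^ (P.p - 1) * C.Mι * max 1 (P.M ^ P.p))

/-- `ℭ₃`. -/
def constFrak3 {d m : ℕ} (P : Problem d m) (C : Consts) : ℝ :=
  2 * C.Lgrad * (1 + P.M) ^ C.ν + 2 ^ P.p * C.Lι * max 1 (P.M ^ P.p)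
    + P.η₁ + P.η₂ * C.Lιι + 1

/-- `L̃_δ = ℭ₂ / δ + ℭ₃`. -/
def constLtilde {d m : ℕ} (P : Problem d m) (C : Consts) (δ : ℝ) : ℝ :=
  constFrak2 P C / δ + constFrak3 P C

/-- The maximal step size `λ_{max,δ} = min {ℭ₁ / L̃_δ², 1/a}`. -/
def lamMax {d m : ℕ} (P : Problem d m) (C : Consts) (δ : ℝ) : ℝ :=
  min (constFrak1 P C / constLtilde P C δ ^ 2) (1 / constA P C)

/-- `𝔐₁`. -/
def constM1 {d m : ℕ} (P : Problem d m) (C : Consts) : ℝ :=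
  (C.Kgrad * (1 + P.M) ^ C.ν + 2 ^ P.p * C.Mι * P.M + P.η₂ * iota 0 * deriv iota 0) ^ 2

/-- `𝔠_{1,δ,β} = 2 𝔐₁ λ_{max,δ} + 2 b + 2 (d+1) / β`. -/
def constc1 {d m : ℕ} (P : Problem d m) (C : Consts) (δ β : ℝ) : ℝ :=
  2 * constM1 P C * lamMax P C δ + 2 * constB P C + 2 * (d + 1) / β

/-- `ℭ₄`. -/
def constFrak4 {d m : ℕ} (P : Problem d m) (C : Consts) : ℝ :=
  C.J * (1 + 2 * P.M) ^ C.χ +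
    8 * P.p * Ktilde P C / Real.sqrt P.η₂ * (1 + 4 * P.M) ^ (C.ν + P.p - 1)

/-- `C̃₄`. -/
def constC4 {d m : ℕ} (P : Problem d m) (C : Consts) : ℝ :=
  C.J * (1 + P.M) ^ C.χ
    + 4 * P.p / Real.sqrt P.η₂ * (1 + 4 * P.M) ^ (P.p - 1)
        * (1 + 2 * Ktilde P C * (1 + P.M) ^ C.ν)
    + 2 ^ (P.p + 2) * P.p * P.M / P.η₂ * (1 + 4 * P.M) ^ (P.p - 1)

/-- `C_{5,δ,β} = ℭ₄ 𝔠_{1,δ,β}^(1/2) (λ_{max,δ} + a⁻¹)^(1/2)`. -/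
def constC5 {d m : ℕ} (P : Problem d m) (C : Consts) (δ β : ℝ) : ℝ :=
  constFrak4 P C * Real.sqrt (constc1 P C δ β) * Real.sqrt (lamMax P C δ + (constA P C)⁻¹)

/-- `C₆ = ℭ₄ (E|θ̄₀|²)^(1/2)`. -/
def constC6 {Ω : Type*} [MeasurableSpace Ω] {d m : ℕ} (P : Problem d m) (C : Consts)
    (Pr : Measure Ω) (θ₀ : Ω → Euc (d + 1)) : ℝ :=
  constFrak4 P C * Real.sqrt (∫ ω, ‖θ₀ ω‖ ^ 2 ∂Pr)

end DRO

end

open DRO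

/-!
Write `t = |θ|`, `g = K_∇ (1 + M_Ξ)^ν` and `k = K̃_∇ (1 + M_Ξ)^ν`. The claim follows from a bound
of the discretisation error at a fixed `θ` that is affine in `t`, and from a bound of
`E |θ̂_n|`.

**Discretisation at a fixed parameter** (`abs_u_sub_uGrid_le`). Rounding to the grid moves points
by at most `ε = √m / 2ʲ`. A competitor for `u` becomes one for `u^{ℓ,j}` by rounding it, together
with its couplings; a competitor for `u^{ℓ,j}` is one for `u`, and its couplings with the rounded
reference measure lift to couplings with `μ₀` by disintegration (`exists_coupling_lift`). Either
way the transport cost grows by at most `Δ = 2 p (1 + 4 M_Ξ)^(p-1) ε`. The penalty is quadratic in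
the cost, so this leaves a term `Δ² / (2 η₂)` of second order. `robustObjective_le_add` disposes
of it as follows: if `Δ ≥ √η₂ / 2`, the asserted bound exceeds the oscillation `2 k (1 + t)` of
the loss, which bounds the difference trivially; otherwise the term is dominated by one linear in
`Δ`. Only competitors with cost at most `2 √(η₂ k (1 + t))` matter, whence the factor `1 / √η₂`.

**Moments of the iterates** (`memLp_thetaPart_sgld_and_integral_norm_le`). The `θ`-components
satisfy `θ̂_{n+1} = (1 - λ η₁) θ̂_n - λ G_n + √(2λ/β) Z_{n+1}` with `|G_n| ≤ g`, as `G_n` is a convex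
combination of gradients. Hence `|θ̂_n| ≤ (1 - λ η₁)ⁿ |θ̄₀| + g / η₁ + |S_n|`, where `S_n` is a linear
combination of the `Z_i`, whose second moment follows from their orthogonality. The initial value
is split off pathwise, so that it need not be independent of the noise. Since `η₁ ≥ 2a` and
`2n ≥ n + 1` for `n ≥ 1`, the first term decays like `exp (-a λ (n + 1))`; the others, increased
by `1`, are absorbed in `𝔠₁^(1/2) (λ_max + 1/a)^(1/2)` (`one_add_stationary_le`), where
`a_ι ≤ b_ι` is used.
-/

namespace DRO

/-! ### Transport costs under a small displacement -/

/-- Mean value bound for `t ↦ tᵖ` on `[0, R]`. -/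
theorem abs_rpow_sub_rpow_le {p R a b : ℝ} (hp : 1 ≤ p) (ha : a ∈ Set.Icc 0 R)
    (hb : b ∈ Set.Icc 0 R) : |a ^ p - b ^ p| ≤ p * R ^ (p - 1) * |a - b| := by
  have h := Convex.norm_image_sub_le_of_norm_hasDerivWithin_le (f := fun t : ℝ => t ^ p)
    (f' := fun t => p * t ^ (p - 1)) (s := Set.Icc 0 R) (C := p * R ^ (p - 1)) (x := b) (y := a)
    (fun t _ => (Real.hasDerivAt_rpow_const (Or.inr hp)).hasDerivWithinAt)
    (fun t ht => by
      have h0 : 0 ≤ t ^ (p - 1) := Real.rpow_nonneg ht.1 _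
      rw [Real.norm_of_nonneg (by positivity)]
      exact mul_le_mul_of_nonneg_left (Real.rpow_le_rpow ht.1 ht.2 (by linarith)) (by linarith))
    (convex_Icc 0 R) hb ha
  simpa only [Real.norm_eq_abs] using h

variable {m : ℕ} {A B : Set (Euc m)} {μ ν : Measure (Euc m)}

theorem ae_mem_of_mem_probOn (h : μ ∈ probOn A) : ∀ᵐ x ∂μ, x ∈ A := h.2

theorem restrict_eq_of_mem_probOn (h : μ ∈ probOn A) : μ.restrict A = μ :=
  Measure.restrict_eq_self_of_ae_mem h.2

theorem probOn_mono (hAB : A ⊆ B) : probOn A ⊆ probOn B := fun _ h =>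
  ⟨h.1, measure_mono_null (Set.compl_subset_compl.2 hAB) h.2⟩

theorem map_mem_probOn {f : Euc m → Euc m} (hf : Measurable f) (hB : MeasurableSet B)
    (hfAB : ∀ x ∈ A, f x ∈ B) (h : μ ∈ probOn A) : μ.map f ∈ probOn B := by
  have := h.1
  refine ⟨Measure.isProbabilityMeasure_map hf.aemeasurable, ?_⟩
  rw [Measure.map_apply hf hB.compl]
  exact measure_mono_null (fun x hx hxA => hx (hfAB x hxA)) h.2

theorem ae_mem_of_mem_couplings {ζ : Measure (Euc m × Euc m)} (hζ : ζ ∈ couplings μ ν)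
    (hμ : μ ∈ probOn A) (hν : ν ∈ probOn B) : ∀ᵐ z ∂ζ, z.1 ∈ A ∧ z.2 ∈ B := by
  obtain ⟨-, rfl, rfl⟩ := hζ
  exact (ae_of_ae_map measurable_fst.aemeasurable hμ.2).and
    (ae_of_ae_map measurable_snd.aemeasurable hν.2)

theorem couplings_nonempty [IsProbabilityMeasure μ] [IsProbabilityMeasure ν] :
    (couplings μ ν).Nonempty :=
  ⟨μ.prod ν, inferInstance, by simp, by simp⟩

theorem transportCost_nonneg (p : ℝ) (μ ν : Measure (Euc m)) : 0 ≤ transportCost p μ ν := by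
  refine Real.sInf_nonneg ?_
  rintro _ ⟨ζ, -, rfl⟩
  exact integral_nonneg fun z => Real.rpow_nonneg (norm_nonneg _) _

theorem transportCost_le {p : ℝ} {ζ : Measure (Euc m × Euc m)} (hζ : ζ ∈ couplings μ ν) :
    transportCost p μ ν ≤ ∫ z, ‖z.1 - z.2‖ ^ p ∂ζ := by
  refine csInf_le ⟨0, ?_⟩ ⟨ζ, hζ, rfl⟩
  rintro _ ⟨ζ, -, rfl⟩
  exact integral_nonneg fun z => Real.rpow_nonneg (norm_nonneg _) _

theorem transportCost_self {p : ℝ} (hp : 1 ≤ p) [IsProbabilityMeasure μ] :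
    transportCost p μ μ = 0 := by
  refine le_antisymm ?_ (transportCost_nonneg _ _ _)
  have hmeas : Measurable fun x : Euc m => (x, x) := by fun_prop
  have hζ : μ.map (fun x => (x, x)) ∈ couplings μ μ := by
    refine ⟨Measure.isProbabilityMeasure_map hmeas.aemeasurable, ?_, ?_⟩
    · rw [Measure.map_map measurable_fst hmeas]; exact Measure.map_id
    · rw [Measure.map_map measurable_snd hmeas]; exact Measure.map_id
  refine (transportCost_le hζ).trans (le_of_eq ?_)
  have hp0 : 0 ≤ p := by linarith
  rw [integral_map hmeas.aemeasurable (by fun_prop)]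
  simp [Real.zero_rpow (by linarith : p ≠ 0)]

theorem transportCost_le_add {p Δ : ℝ} {μ' ν' : Measure (Euc m)}
    (hne : (couplings μ ν).Nonempty)
    (h : ∀ ζ ∈ couplings μ ν, ∃ ζ' ∈ couplings μ' ν',
      ∫ z, ‖z.1 - z.2‖ ^ p ∂ζ' ≤ ∫ z, ‖z.1 - z.2‖ ^ p ∂ζ + Δ) :
    transportCost p μ' ν' ≤ transportCost p μ ν + Δ := by
  rw [← sub_le_iff_le_add]
  refine le_csInf (hne.image _) ?_
  rintro _ ⟨ζ, hζ, rfl⟩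
  obtain ⟨ζ', hζ', hle⟩ := h ζ hζ
  have := transportCost_le (p := p) hζ'
  simp only
  linarith

/-- Displacing both points of a coupling by at most `ε` inside a ball of radius `M` changes the
expected cost by at most `2 p (1 + 4M)^(p-1) ε`. -/
theorem integral_cost_le_add {p M ε : ℝ} (hp : 1 ≤ p) (hM : 0 ≤ M)
    {ζ : Measure (Euc m × Euc m)} [IsProbabilityMeasure ζ] {f g : Euc m × Euc m → Euc m}
    (hf : Measurable f) (hg : Measurable g)
    (h : ∀ᵐ z ∂ζ, (‖z.1‖ ≤ M ∧ ‖z.2‖ ≤ M) ∧ (‖f z‖ ≤ M ∧ ‖g z‖ ≤ M) ∧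
      ‖z.1 - f z‖ ≤ ε ∧ ‖z.2 - g z‖ ≤ ε) :
    |∫ z, ‖f z - g z‖ ^ p ∂ζ - ∫ z, ‖z.1 - z.2‖ ^ p ∂ζ|
      ≤ 2 * p * (1 + 4 * M) ^ (p - 1) * ε := by
  have hint : ∀ {f g : Euc m × Euc m → Euc m}, Measurable f → Measurable g →
      (∀ᵐ z ∂ζ, ‖f z‖ ≤ M ∧ ‖g z‖ ≤ M) → Integrable (fun z => ‖f z - g z‖ ^ p) ζ := by
    intro f g hf hg hfg
    refine Integrable.of_bound ((hf.sub hg).norm.pow_const p).aestronglyMeasurable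
      ((M + M) ^ p) ?_
    filter_upwards [hfg] with z hz
    rw [Real.norm_of_nonneg (by positivity)]
    exact Real.rpow_le_rpow (norm_nonneg _)
      ((norm_sub_le _ _).trans (add_le_add hz.1 hz.2)) (by linarith)
  rw [← integral_sub (hint hf hg (h.mono fun z hz => hz.2.1))
    (hint measurable_fst measurable_snd (h.mono fun z hz => hz.1)), ← Real.norm_eq_abs]
  refine (norm_integral_le_of_norm_le_const (C := 2 * p * (1 + 4 * M) ^ (p - 1) * ε) ?_).trans
    (by simp)
  filter_upwards [h] with z hz
  obtain ⟨⟨h1, h2⟩, ⟨h3, h4⟩, h5, h6⟩ := hz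
  have ha : ‖f z - g z‖ ≤ 1 + 4 * M := (norm_sub_le _ _).trans (by linarith)
  have hb : ‖z.1 - z.2‖ ≤ 1 + 4 * M := (norm_sub_le _ _).trans (by linarith)
  have hab : |‖f z - g z‖ - ‖z.1 - z.2‖| ≤ 2 * ε := by
    refine (abs_norm_sub_norm_le _ _).trans ?_
    have : f z - g z - (z.1 - z.2) = (z.2 - g z) - (z.1 - f z) := by abel
    rw [this]
    exact (norm_sub_le _ _).trans (by linarith)
  rw [Real.norm_eq_abs]
  refine (abs_rpow_sub_rpow_le hp ⟨norm_nonneg _, ha⟩ ⟨norm_nonneg _, hb⟩).trans ?_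
  have : 0 ≤ p * (1 + 4 * M) ^ (p - 1) := by positivity
  nlinarith

/-- A coupling of `f_* μ` and `ν` lifts along `f` to a coupling of `μ` and `ν`: disintegrate the
given coupling over its first marginal and pull the conditional laws back by `f`. -/
theorem exists_coupling_lift [IsProbabilityMeasure μ] {f : Euc m → Euc m} (hf : Measurable f)
    {ζ : Measure (Euc m × Euc m)} (hζ : ζ ∈ couplings (μ.map f) ν) :
    ∃ ζ' ∈ couplings μ ν, ζ'.map (Prod.map f id) = ζ := by
  obtain ⟨_, h1, h2⟩ := hζ
  have hfid : Measurable (Prod.map f (id : Euc m → Euc m)) := hf.prodMap measurable_id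
  have hmap : (μ ⊗ₘ ζ.condKernel.comap f hf).map (Prod.map f id) = ζ := by
    conv_rhs => rw [← ζ.disintegrate ζ.condKernel]
    ext s hs
    rw [Measure.map_apply hfid hs, Measure.compProd_apply (hfid hs), Measure.compProd_apply hs,
      Measure.fst, h1, lintegral_map (Kernel.measurable_kernel_prodMk_left hs) hf]
    rfl
  refine ⟨μ ⊗ₘ ζ.condKernel.comap f hf, ⟨inferInstance, Measure.fst_compProd _ _, ?_⟩, hmap⟩
  have h3 := congrArg (Measure.map Prod.snd) hmap
  rw [Measure.map_map measurable_snd hfid, h2] at h3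
  exact h3

/-- Pushing both arguments forward by a map that moves points by at most `ε`. -/
theorem transportCost_map_le {p M ε : ℝ} (hp : 1 ≤ p) (hM : 0 ≤ M) (hA : ∀ x ∈ A, ‖x‖ ≤ M)
    {f : Euc m → Euc m} (hf : Measurable f) (hfA : ∀ x ∈ A, f x ∈ A)
    (hfε : ∀ x, ‖x - f x‖ ≤ ε) (hμ : μ ∈ probOn A) (hν : ν ∈ probOn A) :
    transportCost p (μ.map f) (ν.map f) ≤
      transportCost p μ ν + 2 * p * (1 + 4 * M) ^ (p - 1) * ε := by
  have := hμ.1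
  have := hν.1
  refine transportCost_le_add couplings_nonempty fun ζ hζ => ?_
  have hp0 : 0 ≤ p := by linarith
  have hff : Measurable (Prod.map f f) := hf.prodMap hf
  have := hζ.1
  refine ⟨ζ.map (Prod.map f f), ⟨Measure.isProbabilityMeasure_map hff.aemeasurable, ?_, ?_⟩, ?_⟩
  · rw [← hζ.2.1, Measure.map_map measurable_fst hff, Measure.map_map hf measurable_fst]; rfl
  · rw [← hζ.2.2, Measure.map_map measurable_snd hff, Measure.map_map hf measurable_snd]; rfl
  · rw [integral_map hff.aemeasurable (by fun_prop), ← sub_le_iff_le_add']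
    refine (le_abs_self _).trans (integral_cost_le_add (f := fun z => f z.1) (g := fun z => f z.2)
      hp hM (by fun_prop) (by fun_prop) ?_)
    filter_upwards [ae_mem_of_mem_couplings hζ hμ hν] with z hz
    exact ⟨⟨hA _ hz.1, hA _ hz.2⟩, ⟨hA _ (hfA _ hz.1), hA _ (hfA _ hz.2)⟩, hfε _, hfε _⟩

/-- Undoing a displacement by at most `ε` of the first argument alone. -/
theorem transportCost_le_map_left {p M ε : ℝ} (hp : 1 ≤ p) (hM : 0 ≤ M) (hε : 0 ≤ ε)
    (hA : ∀ x ∈ A, ‖x‖ ≤ M) {f : Euc m → Euc m} (hf : Measurable f) (hfA : ∀ x ∈ A, f x ∈ A)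
    (hfε : ∀ x, ‖x - f x‖ ≤ ε) (hμ : μ ∈ probOn A) (hν : ν ∈ probOn A) :
    transportCost p μ ν ≤
      transportCost p (μ.map f) ν + 2 * p * (1 + 4 * M) ^ (p - 1) * ε := by
  have := hμ.1
  have := hν.1
  have := Measure.isProbabilityMeasure_map (μ := μ) hf.aemeasurable
  refine transportCost_le_add couplings_nonempty fun ζ hζ => ?_
  obtain ⟨ζ', hζ', rfl⟩ := exists_coupling_lift hf hζ
  have hfid : Measurable (Prod.map f (id : Euc m → Euc m)) := hf.prodMap measurable_id
  have := hζ'.1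
  have hp0 : 0 ≤ p := by linarith
  refine ⟨ζ', hζ', ?_⟩
  rw [integral_map hfid.aemeasurable (by fun_prop), ← sub_le_iff_le_add']
  refine (le_abs_self _).trans ?_
  rw [abs_sub_comm]
  refine integral_cost_le_add (f := fun z => f z.1) (g := fun z => z.2)
      hp hM (by fun_prop) (by fun_prop) ?_
  filter_upwards [ae_mem_of_mem_couplings hζ' hμ hν] with z hz
  exact ⟨⟨hA _ hz.1, hA _ hz.2⟩, ⟨hA _ (hfA _ hz.1), hA _ hz.2⟩, hfε _, by simpa using hε⟩

/-! ### Rounding to the dyadic grid -/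

theorem norm_sub_dyadicFloor_le (j : ℕ) (x : Euc m) :
    ‖x - dyadicFloor j x‖ ≤ Real.sqrt m / 2 ^ j := by
  have h2 : (0 : ℝ) < 2 ^ j := by positivity
  have hi : ∀ i, ‖(x - dyadicFloor j x) i‖ ^ 2 ≤ (1 / 2 ^ j : ℝ) ^ 2 := by
    intro i
    have e : (x - dyadicFloor j x) i = Int.fract ((2 : ℝ) ^ j * x i) / 2 ^ j := by
      simp only [dyadicFloor, PiLp.sub_apply, Int.fract]
      field_simp
    rw [e, Real.norm_of_nonneg (div_nonneg (Int.fract_nonneg _) h2.le)]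
    have := Int.fract_nonneg ((2 : ℝ) ^ j * x i)
    have := (Int.fract_lt_one ((2 : ℝ) ^ j * x i)).le
    gcongr
  rw [EuclideanSpace.norm_eq, show Real.sqrt m / 2 ^ j = Real.sqrt (m * (1 / 2 ^ j : ℝ) ^ 2) by
    rw [Real.sqrt_mul (by positivity), Real.sqrt_sq (by positivity)]; ring]
  refine Real.sqrt_le_sqrt ((Finset.sum_le_sum fun i _ => hi i).trans ?_)
  simp

theorem dyadicFloor_mem_dyadicGrid {ℓ : ℕ} (hℓ : 1 ≤ ℓ) (j : ℕ) {x : Euc m} (hx : x ∈ box m ℓ) :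
    dyadicFloor j x ∈ dyadicGrid m ℓ j := by
  intro i
  have h2 : (0 : ℝ) < 2 ^ j := by positivity
  obtain ⟨h1, h3⟩ := hx i
  have hlo : -(2 ^ (ℓ - 1) * 2 ^ j : ℤ) ≤ ⌊(2 : ℝ) ^ j * x i⌋ := by
    rw [Int.le_floor]; push_cast; nlinarith
  have hhi : ⌊(2 : ℝ) ^ j * x i⌋ < (2 ^ (ℓ - 1) * 2 ^ j : ℤ) := by
    rw [Int.floor_lt]; push_cast; nlinarith
  obtain ⟨k, hk⟩ := Int.eq_ofNat_of_zero_le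
    (by linarith : 0 ≤ ⌊(2 : ℝ) ^ j * x i⌋ + 2 ^ (ℓ - 1) * 2 ^ j)
  refine ⟨k, ?_, ?_⟩
  · have hpow : (2 : ℤ) ^ (ℓ + j) = 2 * (2 ^ (ℓ - 1) * 2 ^ j) := by
      obtain ⟨r, rfl⟩ := Nat.exists_eq_add_of_le hℓ
      rw [Nat.add_sub_cancel_left]; ring
    have : (k : ℤ) < (2 : ℤ) ^ (ℓ + j) := by rw [hpow, ← hk]; linarith
    exact_mod_cast this
  · have hk' : (⌊(2 : ℝ) ^ j * x i⌋ : ℝ) + 2 ^ (ℓ - 1) * 2 ^ j = k := by exact_mod_cast hk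
    simp only [dyadicFloor]
    rw [← hk']
    field_simp
    ring

theorem measurableSet_dyadicGrid (m ℓ j : ℕ) : MeasurableSet (dyadicGrid m ℓ j) := by
  have : dyadicGrid m ℓ j = ⋂ i : Fin m, ⋃ k ∈ {k : ℕ | k < 2 ^ (ℓ + j)},
      {x : Euc m | x i = -(2 : ℝ) ^ (ℓ - 1) + k / (2 : ℝ) ^ j} := by
    ext x
    simp [dyadicGrid]
  rw [this]
  refine MeasurableSet.iInter fun i => MeasurableSet.biUnion (Set.to_countable _) fun k _ => ?_
  exact measurableSet_eq_fun (by fun_prop) measurable_const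

/-! ### Growth and regularity of the loss -/

section Loss

variable {d m : ℕ} {P : Problem d m} {C : Consts}

theorem Problem.M_nonneg (P : Problem d m) : 0 ≤ P.M := by
  refine Real.sSup_nonneg ?_
  rintro _ ⟨x, -, rfl⟩
  exact norm_nonneg x

theorem Problem.norm_le_M (hΞ : IsCompact P.Ξ) {x : Euc m} (hx : x ∈ P.Ξ) : ‖x‖ ≤ P.M :=
  le_csSup (hΞ.image continuous_norm).bddAbove ⟨x, hx, rfl⟩

/-- The bound `K_∇ (1 + M_Ξ)^ν` of `∇_θ U` on `ℝᵈ × Ξ`. -/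
noncomputable def gradBound (P : Problem d m) (C : Consts) : ℝ := C.Kgrad * (1 + P.M) ^ C.ν

theorem gradBound_nonneg (hgrad : P.GradientBounds C) : 0 ≤ gradBound P C := by
  have := P.M_nonneg
  have := hgrad.2.1
  unfold gradBound
  positivity

theorem norm_gradU_le (hΞ : IsCompact P.Ξ) (hgrad : P.GradientBounds C) (θ : Euc d) {x : Euc m}
    (hx : x ∈ P.Ξ) : ‖P.gradU θ x‖ ≤ gradBound P C := by
  have := hgrad.2.1
  have := Problem.norm_le_M hΞ hx
  refine (hgrad.2.2.2 θ x hx).trans ?_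
  unfold gradBound
  gcongr

theorem abs_U_sub_U_le (hΞ : IsCompact P.Ξ) (hreg : P.Regular) (hgrad : P.GradientBounds C)
    (θ₁ θ₂ : Euc d) {x : Euc m} (hx : x ∈ P.Ξ) :
    |P.U θ₁ x - P.U θ₂ x| ≤ gradBound P C * ‖θ₁ - θ₂‖ := by
  rw [← Real.norm_eq_abs]
  refine Convex.norm_image_sub_le_of_norm_fderiv_le (𝕜 := ℝ) (f := fun θ => P.U θ x)
    (fun θ _ => ((hreg.1 x hx).differentiable one_ne_zero) θ) (fun θ _ => ?_) convex_univ
    (Set.mem_univ _) (Set.mem_univ _)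
  have h := norm_gradU_le hΞ hgrad θ hx
  rwa [Problem.gradU, gradient, LinearIsometryEquiv.norm_map] at h

/-- The factor `K̃_∇ (1 + M_Ξ)^ν` of the linear growth of `U` in `θ`. -/
noncomputable def growthBound (P : Problem d m) (C : Consts) : ℝ := Ktilde P C * (1 + P.M) ^ C.ν

theorem one_le_growthBound (hgrad : P.GradientBounds C) : 1 ≤ growthBound P C :=
  one_le_mul_of_one_le_of_one_le (hgrad.2.1.le.trans (le_max_left _ _))
    (one_le_pow₀ (by linarith [P.M_nonneg]))

theorem abs_U_le (hΞ : IsCompact P.Ξ) (hreg : P.Regular) (hgrad : P.GradientBounds C)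
    (θ : Euc d) {x : Euc m} (hx : x ∈ P.Ξ) : |P.U θ x| ≤ growthBound P C * (1 + ‖θ‖) := by
  have h0 : |P.U 0 x| ≤ Ktilde P C :=
    (le_csSup (hΞ.image_of_continuousOn (hreg.2 0).abs).bddAbove
      ⟨x, hx, rfl⟩).trans (le_max_right _ _)
  have h1 := abs_U_sub_U_le hΞ hreg hgrad θ 0 hx
  rw [sub_zero] at h1
  have hK : 0 ≤ Ktilde P C := (abs_nonneg _).trans h0
  have hM : 1 ≤ (1 + P.M) ^ C.ν := one_le_pow₀ (by linarith [P.M_nonneg])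
  have h2 : gradBound P C ≤ growthBound P C :=
    mul_le_mul_of_nonneg_right (le_max_left _ _) (by linarith)
  have h3 : Ktilde P C ≤ growthBound P C := le_mul_of_one_le_right hK hM
  calc |P.U θ x| = |(P.U θ x - P.U 0 x) + P.U 0 x| := by ring_nf
    _ ≤ gradBound P C * ‖θ‖ + Ktilde P C := (abs_add_le _ _).trans (add_le_add h1 h0)
    _ ≤ growthBound P C * ‖θ‖ + growthBound P C := by gcongr
    _ = growthBound P C * (1 + ‖θ‖) := by ring

theorem integrableOn_U (hΞ : IsCompact P.Ξ) (hreg : P.Regular) (θ : Euc d) (μ : Measure (Euc m))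
    [IsFiniteMeasure μ] : IntegrableOn (P.U θ) P.Ξ μ :=
  (hreg.2 θ).integrableOn_compact hΞ

end Loss

/-! ### The robust objective -/

section Objective

variable {d m : ℕ} {P : Problem d m} {A A' : Set (Euc m)} {ρ ρ' : Measure (Euc m)} {s : ℝ}
  {θ : Euc d}

theorem abs_setIntegral_U_le (hs : ∀ x ∈ A, |P.U θ x| ≤ s) {μ : Measure (Euc m)}
    (hμ : μ ∈ probOn A) : |∫ x in A, P.U θ x ∂μ| ≤ s := by
  have := hμ.1
  rw [restrict_eq_of_mem_probOn hμ, ← Real.norm_eq_abs]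
  refine (norm_integral_le_of_norm_le_const (C := s) ?_).trans (by simp)
  filter_upwards [ae_mem_of_mem_probOn hμ] with x hx using hs x hx

theorem le_robustObjective (hη₂ : 0 < P.η₂) (hs : ∀ x ∈ A, |P.U θ x| ≤ s)
    {μ : Measure (Euc m)} (hμ : μ ∈ probOn A) :
    (∫ x in A, P.U θ x ∂μ) - transportCost P.p ρ μ ^ 2 / (2 * P.η₂) + P.η₁ / 2 * ‖θ‖ ^ 2
      ≤ robustObjective P A ρ θ := by
  unfold robustObjective
  gcongr
  refine le_csSup ⟨s, ?_⟩ ⟨μ, hμ, rfl⟩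
  rintro _ ⟨μ', hμ', rfl⟩
  have h1 := (abs_le.1 (abs_setIntegral_U_le hs hμ')).2
  have h2 : 0 ≤ transportCost P.p ρ μ' ^ 2 / (2 * P.η₂) := by positivity
  simp only
  linarith

theorem robustObjective_le (hne : (probOn A).Nonempty) {c : ℝ}
    (h : ∀ μ ∈ probOn A,
      (∫ x in A, P.U θ x ∂μ) - transportCost P.p ρ μ ^ 2 / (2 * P.η₂) ≤ c) :
    robustObjective P A ρ θ ≤ c + P.η₁ / 2 * ‖θ‖ ^ 2 := by
  refine add_le_add_left (csSup_le (hne.image _) ?_) _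
  rintro _ ⟨μ, hμ, rfl⟩
  exact h μ hμ

theorem abs_robustObjective_sub_le (hp : 1 ≤ P.p) (hη₂ : 0 < P.η₂) (hρ : ρ ∈ probOn A)
    (hs : ∀ x ∈ A, |P.U θ x| ≤ s) :
    |robustObjective P A ρ θ - P.η₁ / 2 * ‖θ‖ ^ 2| ≤ s := by
  have := hρ.1
  refine abs_le.2 ⟨?_, ?_⟩
  · have h1 := le_robustObjective (ρ := ρ) hη₂ hs hρ
    rw [transportCost_self hp] at h1
    have h2 := (abs_le.1 (abs_setIntegral_U_le hs hρ)).1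
    simp only [ne_eq, OfNat.ofNat_ne_zero, not_false_eq_true, zero_pow, zero_div, sub_zero] at h1
    linarith
  · rw [sub_le_iff_le_add]
    refine robustObjective_le ⟨ρ, hρ⟩ fun μ hμ => ?_
    have h1 := (abs_le.1 (abs_setIntegral_U_le hs hμ)).2
    have h2 : 0 ≤ transportCost P.p ρ μ ^ 2 / (2 * P.η₂) := by positivity
    linarith

/-- For a competitor `μ` of cost `D` with `D² ≤ 4 h² s`, where `h = √η₂`, a cost increment
`Δ < h / 2` raises the penalty by at most `2 Δ (1 + 2s) / h`. -/
theorem penalty_increment_le {D Δ h s : ℝ} (hh : 0 < h) (hs : 0 ≤ s) (hΔ : 0 ≤ Δ)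
    (hΔh : Δ ≤ h / 2) (hD : D ^ 2 ≤ 4 * h ^ 2 * s) :
    (2 * D * Δ + Δ ^ 2) / (2 * h ^ 2) ≤ 2 * Δ / h * (1 + 2 * s) := by
  have hD' : D ≤ h * (1 + s) := by
    refine abs_le_of_sq_le_sq' ?_ (by positivity) |>.2
    nlinarith [mul_nonneg (sq_nonneg h) (sq_nonneg (1 - s))]
  rw [div_le_iff₀ (by positivity)]
  have e : 2 * Δ / h * (1 + 2 * s) * (2 * h ^ 2) = Δ * (4 * h * (1 + 2 * s)) := by
    field_simp; ring
  rw [e, show 2 * D * Δ + Δ ^ 2 = Δ * (2 * D + Δ) by ring]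
  refine mul_le_mul_of_nonneg_left ?_ hΔ
  nlinarith [mul_nonneg hh.le hs]

/-- Stability of the supremum: if every competitor `μ` for `(A, ρ)` has a counterpart `μ'` for
`(A', ρ')` whose loss is smaller by at most `e` and whose cost is larger by at most `Δ`, then the
objective changes by at most `e + 2 Δ (1 + 2s) / √η₂`. For `Δ ≥ √η₂ / 2` this exceeds the
oscillation `2s` of the loss, and competitors whose penalty exceeds `2s` do not matter; for the
others the penalty increment is controlled. -/
theorem robustObjective_le_add {e Δ : ℝ} (hp : 1 ≤ P.p) (hη₂ : 0 < P.η₂)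
    (hρ : ρ ∈ probOn A) (hρ' : ρ' ∈ probOn A') (hs0 : 0 ≤ s) (he : 0 ≤ e) (hΔ : 0 ≤ Δ)
    (hs : ∀ x ∈ A, |P.U θ x| ≤ s) (hs' : ∀ x ∈ A', |P.U θ x| ≤ s)
    (h : ∀ μ ∈ probOn A, ∃ μ' ∈ probOn A',
      (∫ x in A, P.U θ x ∂μ) ≤ (∫ x in A', P.U θ x ∂μ') + e ∧
      transportCost P.p ρ' μ' ≤ transportCost P.p ρ μ + Δ) :
    robustObjective P A ρ θ ≤
      robustObjective P A' ρ' θ + (e + 2 * Δ / Real.sqrt P.η₂ * (1 + 2 * s)) := by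
  have hh : 0 < Real.sqrt P.η₂ := Real.sqrt_pos.2 hη₂
  have hh2 : Real.sqrt P.η₂ ^ 2 = P.η₂ := Real.sq_sqrt hη₂.le
  have hT : 0 ≤ 2 * Δ / Real.sqrt P.η₂ * (1 + 2 * s) := by positivity
  have hlow := (abs_le.1 (abs_robustObjective_sub_le hp hη₂ hρ' hs')).1
  suffices robustObjective P A ρ θ ≤ (robustObjective P A' ρ' θ - P.η₁ / 2 * ‖θ‖ ^ 2
      + (e + 2 * Δ / Real.sqrt P.η₂ * (1 + 2 * s))) + P.η₁ / 2 * ‖θ‖ ^ 2 by linarith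
  refine robustObjective_le ⟨ρ, hρ⟩ fun μ hμ => ?_
  have hU := (abs_le.1 (abs_setIntegral_U_le hs hμ)).2
  have hpen : 0 ≤ transportCost P.p ρ μ ^ 2 / (2 * P.η₂) := by positivity
  rcases le_or_gt (Real.sqrt P.η₂ / 2) Δ with hΔh | hΔh
  · have h1 : 1 ≤ 2 * Δ / Real.sqrt P.η₂ := by rw [le_div_iff₀ hh]; linarith
    nlinarith
  rcases lt_or_ge (2 * s) (transportCost P.p ρ μ ^ 2 / (2 * P.η₂)) with hD | hD
  · linarith
  obtain ⟨μ', hμ', hUU, hcost⟩ := h μ hμ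
  have hF := le_robustObjective (ρ := ρ') hη₂ hs' hμ'
  have h0 := transportCost_nonneg P.p ρ' μ'
  have hinc := penalty_increment_le (D := transportCost P.p ρ μ) hh hs0 hΔ hΔh.le (by
    rw [div_le_iff₀ (by positivity)] at hD; rw [hh2]; linarith)
  rw [hh2] at hinc
  have hsq : transportCost P.p ρ' μ' ^ 2 / (2 * P.η₂) ≤ transportCost P.p ρ μ ^ 2 / (2 * P.η₂)
      + (2 * transportCost P.p ρ μ * Δ + Δ ^ 2) / (2 * P.η₂) := by
    rw [← add_div]
    refine div_le_div_of_nonneg_right ?_ (by positivity)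
    calc _ ≤ (transportCost P.p ρ μ + Δ) ^ 2 := pow_le_pow_left₀ h0 hcost 2
      _ = _ := by ring
  linarith

theorem robustObjective_sub_le {C : Consts} (hΞ : IsCompact P.Ξ) (hη₂ : 0 < P.η₂)
    (hreg : P.Regular) (hgrad : P.GradientBounds C) (hA : A ⊆ P.Ξ) (hρ : ρ ∈ probOn A)
    (θ₁ θ₂ : Euc d) :
    robustObjective P A ρ θ₁ - P.η₁ / 2 * ‖θ₁‖ ^ 2 ≤
      robustObjective P A ρ θ₂ - P.η₁ / 2 * ‖θ₂‖ ^ 2 + gradBound P C * ‖θ₁ - θ₂‖ := by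
  rw [sub_le_iff_le_add]
  refine robustObjective_le ⟨ρ, hρ⟩ fun μ hμ => ?_
  have := hμ.1
  have hF := le_robustObjective (ρ := ρ) hη₂
    (fun x hx => abs_U_le hΞ hreg hgrad θ₂ (hA hx)) hμ
  have hI : ∫ x in A, P.U θ₁ x ∂μ ≤ (∫ x in A, P.U θ₂ x ∂μ) + gradBound P C * ‖θ₁ - θ₂‖ := by
    have i₁ := (integrableOn_U hΞ hreg θ₁ μ).mono_set hA
    have i₂ := (integrableOn_U hΞ hreg θ₂ μ).mono_set hA
    rw [IntegrableOn, restrict_eq_of_mem_probOn hμ] at i₁ i₂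
    rw [restrict_eq_of_mem_probOn hμ, ← sub_le_iff_le_add', ← integral_sub i₁ i₂]
    refine (le_abs_self _).trans ?_
    rw [← Real.norm_eq_abs]
    refine (norm_integral_le_of_norm_le_const (C := gradBound P C * ‖θ₁ - θ₂‖) ?_).trans (by simp)
    filter_upwards [ae_mem_of_mem_probOn hμ] with x hx
      using abs_U_sub_U_le hΞ hreg hgrad θ₁ θ₂ (hA hx)
  linarith

theorem continuous_robustObjective {C : Consts} (hΞ : IsCompact P.Ξ) (hη₂ : 0 < P.η₂)
    (hreg : P.Regular) (hgrad : P.GradientBounds C) (hA : A ⊆ P.Ξ) (hρ : ρ ∈ probOn A) :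
    Continuous (robustObjective P A ρ) := by
  have hL : LipschitzWith (gradBound P C).toNNReal
      fun θ => robustObjective P A ρ θ - P.η₁ / 2 * ‖θ‖ ^ 2 := by
    refine LipschitzWith.of_le_add_mul _ fun θ₁ θ₂ => ?_
    rw [Real.coe_toNNReal _ (gradBound_nonneg hgrad), dist_eq_norm]
    exact robustObjective_sub_le hΞ hη₂ hreg hgrad hA hρ θ₁ θ₂
  refine (hL.continuous.add
    (by fun_prop : Continuous fun θ : Euc d => P.η₁ / 2 * ‖θ‖ ^ 2)).congr fun θ => ?_
  simp

/-- The objective composed with a square integrable random parameter is integrable: it is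
continuous with quadratic growth. -/
theorem integrable_robustObjective_comp {C : Consts} (hΞ : IsCompact P.Ξ) (hp : 1 ≤ P.p)
    (hη₂ : 0 < P.η₂) (hreg : P.Regular) (hgrad : P.GradientBounds C) (hA : A ⊆ P.Ξ)
    (hρ : ρ ∈ probOn A) {Ω : Type*} [MeasurableSpace Ω] {Pr : Measure Ω} [IsProbabilityMeasure Pr]
    {T : Ω → Euc d} (hT : MemLp T 2 Pr) :
    Integrable (fun ω => robustObjective P A ρ (T ω)) Pr := by
  have hcont := continuous_robustObjective hΞ hη₂ hreg hgrad hA hρ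
  have h1 : Integrable (fun ω => ‖T ω‖) Pr := (hT.integrable one_le_two).norm
  have h2 : Integrable (fun ω => ‖T ω‖ ^ 2) Pr := hT.integrable_norm_pow two_ne_zero
  refine (((integrable_const 1).add h1).const_mul (growthBound P C)
    |>.add (h2.const_mul |P.η₁ / 2|)).mono' (hcont.comp_aestronglyMeasurable hT.1)
    (.of_forall fun ω => ?_)
  have h3 := abs_robustObjective_sub_le (ρ := ρ) hp hη₂ hρ
    (fun x hx => abs_U_le hΞ hreg hgrad (T ω) (hA hx))
  have h4 : |P.η₁ / 2 * ‖T ω‖ ^ 2| = |P.η₁ / 2| * ‖T ω‖ ^ 2 := by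
    rw [abs_mul, abs_of_nonneg (by positivity : (0 : ℝ) ≤ ‖T ω‖ ^ 2)]
  rw [Real.norm_eq_abs]
  calc |robustObjective P A ρ (T ω)|
      = |(robustObjective P A ρ (T ω) - P.η₁ / 2 * ‖T ω‖ ^ 2) + P.η₁ / 2 * ‖T ω‖ ^ 2| := by ring_nf
    _ ≤ _ := (abs_add_le _ _).trans (add_le_add h3 h4.le)

end Objective

/-! ### The discretisation error at a fixed parameter -/

section Discretisation

variable {d m : ℕ} {P : Problem d m} {C : Consts}

theorem gridMeasure_mem_probOn {ℓ j : ℕ} (hΞ : IsCompact P.Ξ) (hℓ : 1 ≤ ℓ)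
    (hbox : P.Ξ ⊆ box m ℓ) (hj : ∀ y ∈ P.Ξ, dyadicFloor j y ∈ P.Ξ) {μ : Measure (Euc m)}
    (hμ : μ ∈ probOn P.Ξ) :
    gridMeasure j μ ∈ probOn (P.Ξ ∩ dyadicGrid m ℓ j) :=
  map_mem_probOn (measurable_dyadicFloor j)
    (hΞ.isClosed.measurableSet.inter (measurableSet_dyadicGrid m ℓ j))
    (fun x hx => ⟨hj x hx, dyadicFloor_mem_dyadicGrid hℓ j (hbox hx)⟩) hμ

theorem setIntegral_U_le_map_add {f : Euc m → Euc m} (hf : Measurable f) {e : ℝ}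
    (hΞ : IsCompact P.Ξ) (hreg : P.Regular) {B : Set (Euc m)} (hB : MeasurableSet B)
    (hBΞ : B ⊆ P.Ξ) (hfB : ∀ x ∈ P.Ξ, f x ∈ B) {θ : Euc d}
    (he : ∀ x ∈ P.Ξ, P.U θ x ≤ P.U θ (f x) + e) {μ : Measure (Euc m)} (hμ : μ ∈ probOn P.Ξ) :
    ∫ x in P.Ξ, P.U θ x ∂μ ≤ (∫ x in B, P.U θ x ∂(μ.map f)) + e := by
  have := hμ.1
  have hmap := map_mem_probOn hf hB hfB hμ
  have := hmap.1
  have i₁ := integrableOn_U hΞ hreg θ μ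
  have i₂ := (integrableOn_U hΞ hreg θ (μ.map f)).mono_set hBΞ
  rw [IntegrableOn, restrict_eq_of_mem_probOn hμ] at i₁
  rw [IntegrableOn, restrict_eq_of_mem_probOn hmap] at i₂
  have i₃ : Integrable (fun x => P.U θ (f x)) μ := i₂.comp_measurable hf
  rw [restrict_eq_of_mem_probOn hμ, restrict_eq_of_mem_probOn hmap,
    integral_map hf.aemeasurable i₂.1]
  calc ∫ x, P.U θ x ∂μ ≤ ∫ x, (P.U θ (f x) + e) ∂μ := by
        refine integral_mono_ae i₁ (i₃.add (integrable_const e)) ?_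
        filter_upwards [ae_mem_of_mem_probOn hμ] with x hx using he x hx
    _ = _ := by rw [integral_add i₃ (integrable_const e)]; simp

/-- Passing from `u` to `u^{ℓ,j}` a competitor is rounded to the grid, and the same rounding is
applied to its couplings with `μ₀`. Conversely, a competitor on the grid also competes for `u`,
and its couplings with the rounded `μ₀` lift to couplings with `μ₀`. -/
theorem abs_u_sub_uGrid_le (hΞ : IsCompact P.Ξ) (hμ₀ : P.μ₀ ∈ probOn P.Ξ) (hp : 1 ≤ P.p)
    (hη₂ : 0 < P.η₂) (hreg : P.Regular) (hgrad : P.GradientBounds C) (hlip : P.LipschitzInData C)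
    {ℓ j : ℕ} (hℓ : 1 ≤ ℓ) (hbox : P.Ξ ⊆ box m ℓ) (hj : ∀ y ∈ P.Ξ, dyadicFloor j y ∈ P.Ξ)
    (θ : Euc d) :
    |P.u θ - P.uGrid ℓ j θ| ≤ Real.sqrt m / 2 ^ j *
      (C.J * (1 + 2 * P.M) ^ C.χ * (1 + ‖θ‖) +
        4 * P.p / Real.sqrt P.η₂ * (1 + 4 * P.M) ^ (P.p - 1)
          * (1 + 2 * (growthBound P C * (1 + ‖θ‖)))) := by
  have hM := P.M_nonneg
  have hMx : ∀ x ∈ P.Ξ, ‖x‖ ≤ P.M := fun x hx => Problem.norm_le_M hΞ hx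
  have hε : 0 ≤ Real.sqrt m / 2 ^ j := by positivity
  have hfε := norm_sub_dyadicFloor_le (m := m) j
  have hf := measurable_dyadicFloor (m := m) j
  have hs : ∀ x ∈ P.Ξ, |P.U θ x| ≤ growthBound P C * (1 + ‖θ‖) :=
    fun x hx => abs_U_le hΞ hreg hgrad θ hx
  have hs0 : 0 ≤ growthBound P C * (1 + ‖θ‖) :=
    mul_nonneg (by linarith [one_le_growthBound hgrad]) (by positivity)
  have hJ := hlip.1
  have hgrid := gridMeasure_mem_probOn hΞ hℓ hbox hj hμ₀
  have hsub : P.Ξ ∩ dyadicGrid m ℓ j ⊆ P.Ξ := Set.inter_subset_left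
  have hΔ : 0 ≤ 2 * P.p * (1 + 4 * P.M) ^ (P.p - 1) * (Real.sqrt m / 2 ^ j) := by positivity
  have hT : 2 * (2 * P.p * (1 + 4 * P.M) ^ (P.p - 1) * (Real.sqrt m / 2 ^ j)) / Real.sqrt P.η₂
      = Real.sqrt m / 2 ^ j * (4 * P.p / Real.sqrt P.η₂ * (1 + 4 * P.M) ^ (P.p - 1)) := by ring
  have he : 0 ≤ C.J * (1 + 2 * P.M) ^ C.χ * (1 + ‖θ‖) * (Real.sqrt m / 2 ^ j) := by positivity
  have hround := robustObjective_le_add (θ := θ) hp hη₂ hμ₀ hgrid hs0 he hΔ hs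
    (fun x hx => hs x hx.1) fun μ hμ => by
      refine ⟨gridMeasure j μ, gridMeasure_mem_probOn hΞ hℓ hbox hj hμ, ?_,
        transportCost_map_le hp hM hMx hf hj hfε hμ₀ hμ⟩
      refine setIntegral_U_le_map_add hf hΞ hreg
        (hΞ.isClosed.measurableSet.inter (measurableSet_dyadicGrid m ℓ j)) hsub
        (fun x hx => ⟨hj x hx, dyadicFloor_mem_dyadicGrid hℓ j (hbox hx)⟩) (fun x hx => ?_) hμ
      rw [← sub_le_iff_le_add']
      refine (le_abs_self _).trans ((hlip.2 θ x hx _ (hj x hx)).trans ?_)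
      have h1 : (1 + ‖x‖ + ‖dyadicFloor j x‖) ^ C.χ ≤ (1 + 2 * P.M) ^ C.χ :=
        pow_le_pow_left₀ (by positivity) (by linarith [hMx x hx, hMx _ (hj x hx)]) _
      calc C.J * (1 + ‖θ‖) * (1 + ‖x‖ + ‖dyadicFloor j x‖) ^ C.χ * ‖x - dyadicFloor j x‖
          ≤ C.J * (1 + ‖θ‖) * (1 + 2 * P.M) ^ C.χ * (Real.sqrt m / 2 ^ j) := by
            gcongr
            exact hfε x
        _ = _ := by ring
  have hlift := robustObjective_le_add (θ := θ) hp hη₂ hgrid hμ₀ hs0 le_rfl hΔ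
    (fun x hx => hs x hx.1) hs fun μ hμ => by
      have hμ' := probOn_mono hsub hμ
      refine ⟨μ, hμ', ?_, transportCost_le_map_left hp hM hε hMx hf hj hfε hμ₀ hμ'⟩
      rw [restrict_eq_of_mem_probOn hμ, restrict_eq_of_mem_probOn hμ', add_zero]
  rw [hT] at hround hlift
  rw [abs_sub_le_iff]
  refine ⟨(sub_le_iff_le_add'.2 hround).trans (le_of_eq (by ring)),
    (sub_le_iff_le_add'.2 hlift).trans ?_⟩
  nlinarith

end Discretisation

/-! ### Moments of a Gaussian random walk with contraction -/

section Noise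

variable {Ω : Type*} [MeasurableSpace Ω] {Pr : Measure Ω}

theorem integrable_inner_of_memLp_two {E : Type*} [NormedAddCommGroup E] [InnerProductSpace ℝ E]
    {f g : Ω → E} (hf : MemLp f 2 Pr) (hg : MemLp g 2 Pr) :
    Integrable (fun ω => inner ℝ (f ω) (g ω)) Pr :=
  (hf.norm.integrable_mul hg.norm).mono' (hf.1.inner hg.1)
    (.of_forall fun ω => norm_inner_le_norm (f ω) (g ω))

theorem integral_norm_le_sqrt {E : Type*} [NormedAddCommGroup E] [IsProbabilityMeasure Pr]
    {f : Ω → E} (hf : MemLp f 2 Pr) :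
    ∫ ω, ‖f ω‖ ∂Pr ≤ Real.sqrt (∫ ω, ‖f ω‖ ^ 2 ∂Pr) := by
  refine Real.le_sqrt_of_sq_le ?_
  have h := variance_nonneg (fun ω => ‖f ω‖) Pr
  rw [variance_eq_sub hf.norm] at h
  simpa using h

theorem integral_norm_sq_stdGaussian (n : ℕ) :
    ∫ z, ‖z‖ ^ 2 ∂(stdGaussian (Euc n)) = n := by
  have hsq : Integrable (fun x : ℝ => x ^ 2) (gaussianReal 0 1) :=
    (IsGaussian.memLp_two_id (μ := gaussianReal 0 1)).integrable_sq
  have hvar : ∫ x, x ^ 2 ∂(gaussianReal 0 1) = 1 := by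
    rw [← variance_of_integral_eq_zero measurable_id'.aemeasurable integral_id_gaussianReal,
      variance_fun_id_gaussianReal]
    rfl
  rw [← map_pi_eq_stdGaussian, integral_map (by fun_prop) (by fun_prop)]
  simp_rw [EuclideanSpace.real_norm_sq_eq]
  rw [integral_finsetSum _ fun i _ =>
    integrable_comp_eval (μ := fun _ : Fin n => gaussianReal 0 1) (i := i) hsq]
  simp_rw [integral_comp_eval (μ := fun _ : Fin n => gaussianReal 0 1) (f := fun x => x ^ 2)
    hsq.1, hvar]
  simp

variable {n : ℕ} {Z : ℕ → Ω → Euc n}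

theorem memLp_two_of_map_eq_stdGaussian {Y : Ω → Euc n} (hY : Measurable Y)
    (h : Pr.map Y = stdGaussian (Euc n)) : MemLp Y 2 Pr := by
  have hid : MemLp id 2 (Pr.map Y) := by rw [h]; exact IsGaussian.memLp_two_id
  exact hid.comp_of_map hY.aemeasurable

/-- The noise accumulated by the recursion `S ↦ r S + s Z`, started at `0`. -/
noncomputable def noiseSum (r s : ℝ) (Z : ℕ → Ω → Euc n) : ℕ → Ω → Euc n
  | 0 => 0
  | k + 1 => fun ω => r • noiseSum r s Z k ω + s • Z (k + 1) ω

theorem memLp_noiseSum {r s : ℝ} (hZ : ∀ k, MemLp (Z k) 2 Pr) (k : ℕ) :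
    MemLp (noiseSum r s Z k) 2 Pr := by
  induction k with
  | zero => exact MemLp.zero
  | succ k ih => exact (ih.const_smul r).add ((hZ (k + 1)).const_smul s)

theorem integral_inner_noiseSum {r s : ℝ} (hZ : ∀ k, MemLp (Z k) 2 Pr)
    (horth : ∀ i k, i ≠ k → ∫ ω, inner ℝ (Z i ω) (Z k ω) ∂Pr = 0) (k i : ℕ) (hki : k < i) :
    ∫ ω, inner ℝ (noiseSum r s Z k ω) (Z i ω) ∂Pr = 0 := by
  induction k with
  | zero => simp [noiseSum]
  | succ k ih =>
    have i₁ := integrable_inner_of_memLp_two (memLp_noiseSum (r := r) (s := s) hZ k) (hZ i)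
    have i₂ := integrable_inner_of_memLp_two (hZ (k + 1)) (hZ i)
    simp only [noiseSum, inner_add_left, real_inner_smul_left]
    rw [integral_add (i₁.const_mul r) (i₂.const_mul s), integral_const_mul, integral_const_mul,
      ih (by omega), horth _ _ (by omega)]
    simp

/-- Second moments of the accumulated noise stay below any level `W` that is preserved by
`W ↦ r² W + s² v`, where `v` is the second moment of one increment. -/
theorem integral_norm_sq_noiseSum_le {r s v W : ℝ} (hZ : ∀ k, MemLp (Z k) 2 Pr)
    (horth : ∀ i k, i ≠ k → ∫ ω, inner ℝ (Z i ω) (Z k ω) ∂Pr = 0)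
    (hv : ∀ k, ∫ ω, ‖Z k ω‖ ^ 2 ∂Pr = v) (hW : 0 ≤ W) (hrW : r ^ 2 * W + s ^ 2 * v ≤ W) (k : ℕ) :
    ∫ ω, ‖noiseSum r s Z k ω‖ ^ 2 ∂Pr ≤ W := by
  induction k with
  | zero => simpa [noiseSum] using hW
  | succ k ih =>
    have hS := memLp_noiseSum (r := r) (s := s) hZ k
    have i₁ : Integrable (fun ω => ‖noiseSum r s Z k ω‖ ^ 2) Pr :=
      hS.integrable_norm_pow two_ne_zero
    have i₂ : Integrable (fun ω => ‖Z (k + 1) ω‖ ^ 2) Pr :=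
      (hZ (k + 1)).integrable_norm_pow two_ne_zero
    have i₃ := integrable_inner_of_memLp_two hS (hZ (k + 1))
    have e : ∀ ω, ‖noiseSum r s Z (k + 1) ω‖ ^ 2 = r ^ 2 * ‖noiseSum r s Z k ω‖ ^ 2
        + 2 * r * s * inner ℝ (noiseSum r s Z k ω) (Z (k + 1) ω)
        + s ^ 2 * ‖Z (k + 1) ω‖ ^ 2 := by
      intro ω
      simp only [noiseSum]
      rw [norm_add_sq_real, norm_smul, norm_smul, real_inner_smul_left, real_inner_smul_right,
        mul_pow, mul_pow, Real.norm_eq_abs, Real.norm_eq_abs, sq_abs, sq_abs]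
      ring
    simp_rw [e]
    have i₁₃ : Integrable (fun ω => r ^ 2 * ‖noiseSum r s Z k ω‖ ^ 2
        + 2 * r * s * inner ℝ (noiseSum r s Z k ω) (Z (k + 1) ω)) Pr :=
      (i₁.const_mul _).add (i₃.const_mul _)
    rw [integral_add i₁₃ (i₂.const_mul _), integral_add (i₁.const_mul _) (i₃.const_mul _), integral_const_mul, integral_const_mul,
      integral_const_mul, integral_inner_noiseSum hZ horth k (k + 1) (by omega), hv]
    nlinarith [mul_le_mul_of_nonneg_left ih (sq_nonneg r)]

theorem integral_inner_eq_zero_of_indepFun {Y Y' : Ω → Euc n} (hY : MemLp Y 2 Pr)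
    (hY' : MemLp Y' 2 Pr) [IsProbabilityMeasure Pr] (hind : IndepFun Y Y' Pr)
    (h0 : ∫ ω, Y ω ∂Pr = 0) : ∫ ω, inner ℝ (Y ω) (Y' ω) ∂Pr = 0 := by
  have h := hind.integral_bilin (hY.integrable one_le_two) (hY'.integrable one_le_two) (innerSL ℝ)
  rw [h0, map_zero] at h
  exact h

end Noise

/-! ### The iterates -/

section Iterates

variable {d m N : ℕ} {P : Problem d m} {C : Consts}

@[simp] theorem thetaPart_apply (z : Euc (d + 1)) (i : Fin d) :
    thetaPart z i = z (Fin.castSucc i) := rfl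

theorem norm_thetaPart_le (z : Euc (d + 1)) : ‖thetaPart z‖ ≤ ‖z‖ := by
  rw [EuclideanSpace.norm_eq, EuclideanSpace.norm_eq, Fin.sum_univ_castSucc]
  refine Real.sqrt_le_sqrt (le_add_of_nonneg_right (by positivity))

theorem continuous_thetaPart : Continuous (thetaPart : Euc (d + 1) → Euc d) := by
  unfold thetaPart
  fun_prop

/-- The average of `∇_θ U(θ, ξ_k)` under the Gibbs weights. -/
noncomputable def gibbsGrad (P : Problem d m) (δ : ℝ) (ξ : Fin N → Euc m) (z : Euc (d + 1))
    (x : Euc m) : Euc d :=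
  (∑ k, gibbsWeight P δ ξ z x k)⁻¹ • ∑ k, gibbsWeight P δ ξ z x k • P.gradU (thetaPart z) (ξ k)

theorem thetaPart_stochGrad (δ : ℝ) (ξ : Fin N → Euc m) (z : Euc (d + 1)) (x : Euc m) :
    thetaPart (stochGrad P δ ξ z x) = P.η₁ • thetaPart z + gibbsGrad P δ ξ z x := by
  ext i
  simp [stochGrad, gibbsGrad]

theorem norm_gibbsGrad_le (hΞ : IsCompact P.Ξ) (hgrad : P.GradientBounds C) {δ : ℝ}
    {ξ : Fin N → Euc m} (hξ : ∀ k, ξ k ∈ P.Ξ) (z : Euc (d + 1)) (x : Euc m) :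
    ‖gibbsGrad P δ ξ z x‖ ≤ gradBound P C := by
  have hw : ∀ k, 0 ≤ gibbsWeight P δ ξ z x k := fun k => (Real.exp_pos _).le
  have hs : 0 ≤ ∑ k, gibbsWeight P δ ξ z x k := Finset.sum_nonneg fun k _ => hw k
  have hg := gradBound_nonneg hgrad
  have h : ‖∑ k, gibbsWeight P δ ξ z x k • P.gradU (thetaPart z) (ξ k)‖ ≤
      (∑ k, gibbsWeight P δ ξ z x k) * gradBound P C := by
    rw [Finset.sum_mul]
    refine norm_sum_le_of_le _ fun k _ => ?_
    rw [norm_smul, Real.norm_of_nonneg (hw k)]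
    exact mul_le_mul_of_nonneg_left (norm_gradU_le hΞ hgrad _ (hξ k)) (hw k)
  rw [gibbsGrad, norm_smul, norm_inv, Real.norm_of_nonneg hs]
  calc _ ≤ (∑ k, gibbsWeight P δ ξ z x k)⁻¹ * ((∑ k, gibbsWeight P δ ξ z x k) * gradBound P C) := by
        gcongr
    _ = ((∑ k, gibbsWeight P δ ξ z x k)⁻¹ * ∑ k, gibbsWeight P δ ξ z x k) * gradBound P C := by ring
    _ ≤ 1 * gradBound P C := by
        gcongr
        exact inv_mul_le_one
    _ = _ := one_mul _

theorem continuous_gradU (hreg : P.Regular) {x : Euc m} (hx : x ∈ P.Ξ) :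
    Continuous fun θ => P.gradU θ x := by
  unfold Problem.gradU gradient
  exact (LinearIsometryEquiv.continuous _).comp ((hreg.1 x hx).continuous_fderiv one_ne_zero)

theorem measurable_iota : Measurable iota :=
  Real.measurable_log.comp Real.continuous_cosh.measurable

theorem measurable_stochGrad (hreg : P.Regular) {δ : ℝ} {ξ : Fin N → Euc m}
    (hξ : ∀ k, ξ k ∈ P.Ξ) :
    Measurable fun q : Euc (d + 1) × Euc m => stochGrad P δ ξ q.1 q.2 := by
  have hθ : Measurable fun q : Euc (d + 1) × Euc m => thetaPart q.1 :=
    continuous_thetaPart.measurable.comp measurable_fst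
  have hα : Measurable fun q : Euc (d + 1) × Euc m => alphaPart q.1 := by
    unfold alphaPart; fun_prop
  have hι : Measurable fun q : Euc (d + 1) × Euc m => iota (alphaPart q.1) :=
    measurable_iota.comp hα
  have hι' : Measurable fun q : Euc (d + 1) × Euc m => deriv iota (alphaPart q.1) :=
    (measurable_deriv iota).comp hα
  have hc : ∀ k, Measurable fun q : Euc (d + 1) × Euc m => ‖q.2 - ξ k‖ ^ P.p := fun k =>
    (measurable_snd.sub_const _).norm.pow_const _
  have hw : ∀ k, Measurable fun q : Euc (d + 1) × Euc m => gibbsWeight P δ ξ q.1 q.2 k := fun k =>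
    Real.measurable_exp.comp
      (((((hreg.1 _ (hξ k)).continuous.measurable.comp hθ).sub (hι.mul (hc k))).const_mul _))
  have hW : Measurable fun q : Euc (d + 1) × Euc m => ∑ k, gibbsWeight P δ ξ q.1 q.2 k :=
    Finset.measurable_sum _ fun k _ => hw k
  have hG : ∀ k, Measurable fun q : Euc (d + 1) × Euc m => P.gradU (thetaPart q.1) (ξ k) :=
    fun k => (continuous_gradU hreg (hξ k)).measurable.comp hθ
  have h₁ : Measurable fun q : Euc (d + 1) × Euc m =>
      P.η₁ • thetaPart q.1 + (∑ k, gibbsWeight P δ ξ q.1 q.2 k)⁻¹ •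
        ∑ k, gibbsWeight P δ ξ q.1 q.2 k • P.gradU (thetaPart q.1) (ξ k) :=
    (hθ.const_smul P.η₁).add
      (hW.inv.smul (Finset.measurable_sum _ fun k _ => (hw k).smul (hG k)))
  have h₂ : Measurable fun q : Euc (d + 1) × Euc m =>
      P.η₂ * iota (alphaPart q.1) * deriv iota (alphaPart q.1) -
        (∑ k, gibbsWeight P δ ξ q.1 q.2 k * (deriv iota (alphaPart q.1) * ‖q.2 - ξ k‖ ^ P.p)) /
          ∑ k, gibbsWeight P δ ξ q.1 q.2 k :=
    ((hι.const_mul _).mul hι').sub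
      ((Finset.measurable_sum _ fun k _ => (hw k).mul (hι'.mul (hc k))).div hW)
  unfold stochGrad
  refine (WithLp.measurable_toLp 2 _).comp (measurable_pi_lambda _ fun i => ?_)
  refine Fin.lastCases ?_ (fun i => ?_) i
  · simpa only [Fin.snoc_last] using h₂
  · simp only [Fin.snoc_castSucc]
    exact (by fun_prop : Measurable fun v : Euc d => v i).comp h₁

variable {Ω : Type*} {X : ℕ → Ω → Euc m} {Z : ℕ → Ω → Euc (d + 1)} {θ₀ : Ω → Euc (d + 1)}
  {ξ : Fin N → Euc m} {β δ lam : ℝ}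

/-- The `θ`-components of the iterates are a contracted initial value, plus the accumulated noise,
plus a drift that is bounded pathwise. No independence enters. -/
theorem norm_thetaPart_sgld_le (hΞ : IsCompact P.Ξ) (hη₁ : 0 < P.η₁) (hgrad : P.GradientBounds C)
    (hξ : ∀ k, ξ k ∈ P.Ξ) (hlam : 0 ≤ lam) (hlη : lam * P.η₁ ≤ 1) (n : ℕ) (ω : Ω) :
    ‖thetaPart (sgld P δ β lam ξ θ₀ X Z n ω)‖ ≤ (1 - lam * P.η₁) ^ n * ‖θ₀ ω‖ +
      gradBound P C / P.η₁ +
      ‖noiseSum (1 - lam * P.η₁) (Real.sqrt (2 * lam * β⁻¹)) Z n ω‖ := by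
  have hr : 0 ≤ 1 - lam * P.η₁ := by linarith
  have hg := gradBound_nonneg hgrad
  have key : ∀ n, ‖thetaPart (sgld P δ β lam ξ θ₀ X Z n ω) -
      (1 - lam * P.η₁) ^ n • thetaPart (θ₀ ω) - thetaPart
        (noiseSum (1 - lam * P.η₁) (Real.sqrt (2 * lam * β⁻¹)) Z n ω)‖ ≤ gradBound P C / P.η₁ := by
    intro n
    induction n with
    | zero =>
      have : thetaPart (noiseSum (1 - lam * P.η₁) (Real.sqrt (2 * lam * β⁻¹)) Z 0 ω) = 0 := by
        ext i; simp [noiseSum]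
      rw [this]
      simp only [sgld, pow_zero, one_smul, sub_self, norm_zero]
      positivity
    | succ n ih =>
      set G := gibbsGrad P δ ξ (sgld P δ β lam ξ θ₀ X Z n ω) (X (n + 1) ω) with hG
      have e : thetaPart (sgld P δ β lam ξ θ₀ X Z (n + 1) ω) -
          (1 - lam * P.η₁) ^ (n + 1) • thetaPart (θ₀ ω) - thetaPart
          (noiseSum (1 - lam * P.η₁) (Real.sqrt (2 * lam * β⁻¹)) Z (n + 1) ω) =
          (1 - lam * P.η₁) • (thetaPart (sgld P δ β lam ξ θ₀ X Z n ω) -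
          (1 - lam * P.η₁) ^ n • thetaPart (θ₀ ω) - thetaPart
          (noiseSum (1 - lam * P.η₁) (Real.sqrt (2 * lam * β⁻¹)) Z n ω)) - lam • G := by
        have hH := thetaPart_stochGrad (P := P) δ ξ (sgld P δ β lam ξ θ₀ X Z n ω) (X (n + 1) ω)
        rw [← hG] at hH
        ext i
        have hHi := congrArg (fun v : Euc d => v i) hH
        simp only [thetaPart_apply, PiLp.add_apply, PiLp.smul_apply, smul_eq_mul] at hHi
        simp only [sgld, noiseSum, thetaPart_apply, PiLp.add_apply, PiLp.sub_apply,
          PiLp.smul_apply, smul_eq_mul, hHi]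
        ring
      rw [e]
      refine (norm_sub_le _ _).trans ?_
      rw [norm_smul, norm_smul, Real.norm_of_nonneg hr, Real.norm_of_nonneg hlam]
      have hGn : ‖G‖ ≤ gradBound P C := norm_gibbsGrad_le hΞ hgrad hξ _ _
      calc _ ≤ (1 - lam * P.η₁) * (gradBound P C / P.η₁) + lam * gradBound P C := by gcongr
        _ = gradBound P C / P.η₁ := by field_simp; ring
  have h1 := key n
  have h2 : ‖(1 - lam * P.η₁) ^ n • thetaPart (θ₀ ω)‖ ≤ (1 - lam * P.η₁) ^ n * ‖θ₀ ω‖ := by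
    rw [norm_smul, Real.norm_of_nonneg (by positivity)]
    exact mul_le_mul_of_nonneg_left (norm_thetaPart_le _) (by positivity)
  have h3 := norm_thetaPart_le
    (noiseSum (1 - lam * P.η₁) (Real.sqrt (2 * lam * β⁻¹)) Z n ω)
  rw [sub_sub] at h1
  have h4 := norm_le_norm_add_norm_sub'  (thetaPart (sgld P δ β lam ξ θ₀ X Z n ω))
    ((1 - lam * P.η₁) ^ n • thetaPart (θ₀ ω) + thetaPart
        (noiseSum (1 - lam * P.η₁) (Real.sqrt (2 * lam * β⁻¹)) Z n ω))
  have h5 := norm_add_le ((1 - lam * P.η₁) ^ n • thetaPart (θ₀ ω)) (thetaPart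
        (noiseSum (1 - lam * P.η₁) (Real.sqrt (2 * lam * β⁻¹)) Z n ω))
  linarith

variable [MeasurableSpace Ω] {Pr : Measure Ω}

theorem aemeasurable_sgld (hreg : P.Regular) (hξ : ∀ k, ξ k ∈ P.Ξ) (hX : ∀ n, Measurable (X n))
    (hZ : ∀ n, Measurable (Z n)) (hθ₀ : AEMeasurable θ₀ Pr) (n : ℕ) :
    AEMeasurable (sgld P δ β lam ξ θ₀ X Z n) Pr := by
  induction n with
  | zero => exact hθ₀
  | succ n ih =>
    exact (ih.sub (((measurable_stochGrad hreg hξ).comp_aemeasurable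
      (ih.prodMk (hX (n + 1)).aemeasurable)).const_smul lam)).add
      ((hZ (n + 1)).aemeasurable.const_smul (Real.sqrt (2 * lam * β⁻¹)))

/-- The first absolute moment of the `θ`-components, by Minkowski's inequality. The initial value
may depend on the data and the noise, as it is separated from them before taking expectations. -/
theorem memLp_thetaPart_sgld_and_integral_norm_le [IsProbabilityMeasure Pr] (hΞ : IsCompact P.Ξ)
    (hη₁ : 0 < P.η₁) (hreg : P.Regular) (hgrad : P.GradientBounds C) (hξ : ∀ k, ξ k ∈ P.Ξ)
    (hXm : ∀ n, Measurable (X n)) (hZm : ∀ n, Measurable (Z n))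
    (hZlaw : ∀ n, Pr.map (Z n) = stdGaussian (Euc (d + 1))) (hZind : iIndepFun Z Pr)
    (hθ₀ : MemLp θ₀ 2 Pr) (hβ : 0 < β) (hlam : 0 ≤ lam) (hlη : lam * P.η₁ ≤ 1 / 2) (n : ℕ) :
    MemLp (fun ω => thetaPart (sgld P δ β lam ξ θ₀ X Z n ω)) 2 Pr ∧
    ∫ ω, ‖thetaPart (sgld P δ β lam ξ θ₀ X Z n ω)‖ ∂Pr ≤
      (1 - lam * P.η₁) ^ n * Real.sqrt (∫ ω, ‖θ₀ ω‖ ^ 2 ∂Pr) + gradBound P C / P.η₁ +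
        Real.sqrt (4 / 3 * ((d + 1) / (β * P.η₁))) := by
  have hr : 0 ≤ 1 - lam * P.η₁ := by linarith
  have hZ : ∀ k, MemLp (Z k) 2 Pr := fun k => memLp_two_of_map_eq_stdGaussian (hZm k) (hZlaw k)
  have hS := memLp_noiseSum (r := 1 - lam * P.η₁) (s := Real.sqrt (2 * lam * β⁻¹)) hZ n
  have hbound := norm_thetaPart_sgld_le (β := β) (δ := δ) (X := X) (Z := Z) (θ₀ := θ₀)
    hΞ hη₁ hgrad hξ hlam (by linarith : lam * P.η₁ ≤ 1) n
  have hmem : MemLp (fun ω => (1 - lam * P.η₁) ^ n * ‖θ₀ ω‖ + gradBound P C / P.η₁ +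
      ‖noiseSum (1 - lam * P.η₁) (Real.sqrt (2 * lam * β⁻¹)) Z n ω‖) 2 Pr :=
    ((hθ₀.norm.const_mul _).add (memLp_const _)).add hS.norm
  have hT : MemLp (fun ω => thetaPart (sgld P δ β lam ξ θ₀ X Z n ω)) 2 Pr := by
    refine hmem.of_le (continuous_thetaPart.comp_aestronglyMeasurable
      (aemeasurable_sgld hreg hξ hXm hZm hθ₀.1.aemeasurable n).aestronglyMeasurable)
      (.of_forall fun ω => (hbound ω).trans (le_abs_self _))
  refine ⟨hT, ?_⟩
  have hmean : ∀ k, ∫ ω, Z k ω ∂Pr = 0 := fun k => by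
    rw [← integral_id_stdGaussian (E := Euc (d + 1)), ← hZlaw k,
      integral_map (hZm k).aemeasurable (by fun_prop)]
  have horth : ∀ i k, i ≠ k → ∫ ω, inner ℝ (Z i ω) (Z k ω) ∂Pr = 0 := fun i k hik =>
    integral_inner_eq_zero_of_indepFun (hZ i) (hZ k) (hZind.indepFun hik) (hmean i)
  have hv : ∀ k, ∫ ω, ‖Z k ω‖ ^ 2 ∂Pr = (d : ℝ) + 1 := fun k => by
    have h := integral_norm_sq_stdGaussian (d + 1)
    rw [← hZlaw k, integral_map (hZm k).aemeasurable (by fun_prop)] at h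
    rw [h]; push_cast; rfl
  have hW : 0 ≤ 4 / 3 * (((d : ℝ) + 1) / (β * P.η₁)) := by positivity
  have hrW : (1 - lam * P.η₁) ^ 2 * (4 / 3 * (((d : ℝ) + 1) / (β * P.η₁))) +
      Real.sqrt (2 * lam * β⁻¹) ^ 2 * ((d : ℝ) + 1) ≤ 4 / 3 * (((d : ℝ) + 1) / (β * P.η₁)) := by
    rw [Real.sq_sqrt (by positivity)]
    have e : 4 / 3 * (((d : ℝ) + 1) / (β * P.η₁)) - ((1 - lam * P.η₁) ^ 2 *
        (4 / 3 * (((d : ℝ) + 1) / (β * P.η₁))) + 2 * lam * β⁻¹ * ((d : ℝ) + 1)) =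
        4 / 3 * lam * β⁻¹ * ((d : ℝ) + 1) * (1 / 2 - lam * P.η₁) := by
      field_simp; ring
    have : 0 ≤ 4 / 3 * lam * β⁻¹ * ((d : ℝ) + 1) * (1 / 2 - lam * P.η₁) :=
      mul_nonneg (by positivity) (by linarith)
    linarith
  have hSn := integral_norm_sq_noiseSum_le hZ horth hv hW hrW n
  have iθ : Integrable (fun ω => (1 - lam * P.η₁) ^ n * ‖θ₀ ω‖) Pr :=
    (hθ₀.integrable one_le_two).norm.const_mul _
  have iS := (hS.integrable one_le_two).norm
  calc ∫ ω, ‖thetaPart (sgld P δ β lam ξ θ₀ X Z n ω)‖ ∂Pr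
      ≤ ∫ ω, ((1 - lam * P.η₁) ^ n * ‖θ₀ ω‖ + gradBound P C / P.η₁ +
        ‖noiseSum (1 - lam * P.η₁) (Real.sqrt (2 * lam * β⁻¹)) Z n ω‖) ∂Pr :=
        integral_mono (hT.integrable one_le_two).norm (hmem.integrable one_le_two) hbound
    _ = (1 - lam * P.η₁) ^ n * ∫ ω, ‖θ₀ ω‖ ∂Pr + gradBound P C / P.η₁ +
        ∫ ω, ‖noiseSum (1 - lam * P.η₁) (Real.sqrt (2 * lam * β⁻¹)) Z n ω‖ ∂Pr := by
        have iθ' : Integrable (fun ω => (1 - lam * P.η₁) ^ n * ‖θ₀ ω‖ + gradBound P C / P.η₁) Pr :=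
          iθ.add (integrable_const _)
        rw [integral_add iθ' iS,
          integral_add iθ (integrable_const _), integral_const_mul]
        simp
    _ ≤ _ := by
        gcongr
        · exact integral_norm_le_sqrt hθ₀
        · exact (integral_norm_le_sqrt hS).trans (Real.sqrt_le_sqrt hSn)

end Iterates

/-! ### Comparison of the explicit constants -/

section Constants

variable {d m : ℕ} {P : Problem d m} {C : Consts}

theorem constA_pos (hη₁ : 0 < P.η₁) (hη₂ : 0 < P.η₂) (hι : IotaConsts C) : 0 < constA P C :=
  half_pos (lt_min hη₁ (mul_pos hη₂ hι.2.2.2.1))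

theorem two_mul_constA_le_left : 2 * constA P C ≤ P.η₁ := by
  have := min_le_left P.η₁ (P.η₂ * C.aι)
  unfold constA
  linarith

theorem two_mul_constA_le_right : 2 * constA P C ≤ P.η₂ * C.aι := by
  have := min_le_right P.η₁ (P.η₂ * C.aι)
  unfold constA
  linarith

theorem IotaConsts.Mι_nonneg (hι : IotaConsts C) : 0 ≤ C.Mι := (abs_nonneg _).trans (hι.2.1 0)

theorem IotaConsts.Lι_nonneg (hι : IotaConsts C) : 0 ≤ C.Lι := by
  simpa using (abs_nonneg _).trans (hι.1 1 0)

theorem IotaConsts.Lιι_nonneg (hι : IotaConsts C) : 0 ≤ C.Lιι := by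
  simpa using (abs_nonneg _).trans (hι.2.2.1 1 0)

theorem constFrak1_nonneg (hη₁ : 0 < P.η₁) (hη₂ : 0 < P.η₂) (hι : IotaConsts C) :
    0 ≤ constFrak1 P C := by
  have := constA_pos hη₁ hη₂ hι
  unfold constFrak1
  positivity

theorem lamMax_nonneg (hη₁ : 0 < P.η₁) (hη₂ : 0 < P.η₂) (hι : IotaConsts C) (δ : ℝ) :
    0 ≤ lamMax P C δ := by
  have := constA_pos hη₁ hη₂ hι
  have := constFrak1_nonneg hη₁ hη₂ hι
  exact le_min (by positivity) (by positivity)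

theorem one_le_integral_moment (hΞ : IsCompact P.Ξ) (hμ₀ : P.μ₀ ∈ probOn P.Ξ) (hp : 1 ≤ P.p) :
    1 ≤ ∫ x, (1 + (1 + ‖x‖) ^ (2 * P.p)) ^ 4 ∂P.μ₀ := by
  have := hμ₀.1
  have hM := P.M_nonneg
  have hint : Integrable (fun x => (1 + (1 + ‖x‖) ^ (2 * P.p)) ^ 4) P.μ₀ := by
    refine Integrable.of_bound (C := (1 + (1 + P.M) ^ (2 * P.p)) ^ 4)
      (((measurable_norm.const_add 1).pow_const _).const_add 1 |>.pow_const 4).aestronglyMeasurable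
      ?_
    filter_upwards [ae_mem_of_mem_probOn hμ₀] with x hx
    have := Problem.norm_le_M hΞ hx
    rw [Real.norm_of_nonneg (by positivity)]
    gcongr
  calc (1 : ℝ) = ∫ _, (1 : ℝ) ∂P.μ₀ := by simp
    _ ≤ _ := integral_mono (integrable_const _) hint fun x =>
      one_le_pow₀ (le_add_of_nonneg_right (by positivity))

theorem add_one_le_constLtilde (hη₂ : 0 < P.η₂) (hgrad : P.GradientBounds C)
    (hι : IotaConsts C) {δ : ℝ} (hδ : 0 < δ) : P.η₁ + 1 ≤ constLtilde P C δ := by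
  have hM := P.M_nonneg
  have h1 := hι.Mι_nonneg
  have h2 := hι.Lι_nonneg
  have h3 := hι.Lιι_nonneg
  have h4 := hgrad.1
  have h5 := hgrad.2.1
  have h6 : 0 ≤ max 1 (P.M ^ P.p) := zero_le_one.trans (le_max_left _ _)
  have hF2 : 0 ≤ constFrak2 P C := by unfold constFrak2; positivity
  have hF3 : P.η₁ + 1 ≤ constFrak3 P C := by
    have e1 : 0 ≤ 2 * C.Lgrad * (1 + P.M) ^ C.ν := by positivity
    have e2 : 0 ≤ 2 ^ P.p * C.Lι * max 1 (P.M ^ P.p) := by positivity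
    have e3 : 0 ≤ P.η₂ * C.Lιι := by positivity
    unfold constFrak3
    linarith
  have : 0 ≤ constFrak2 P C / δ := by positivity
  unfold constLtilde
  linarith

/-- Below the maximal step size the contraction factor `1 - λ η₁` of the `θ`-components is at
least `1/2`. -/
theorem mul_le_half_of_lt_lamMax (hΞ : IsCompact P.Ξ) (hμ₀ : P.μ₀ ∈ probOn P.Ξ) (hp : 1 ≤ P.p)
    (hη₁ : 0 < P.η₁) (hη₂ : 0 < P.η₂) (hgrad : P.GradientBounds C) (hι : IotaConsts C)
    {δ lam : ℝ} (hδ : 0 < δ) (hlam : lam < lamMax P C δ) : lam * P.η₁ ≤ 1 / 2 := by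
  have ha := constA_pos hη₁ hη₂ hι
  have hL := add_one_le_constLtilde hη₂ hgrad hι hδ
  have hI : 1 ≤ Real.sqrt (∫ x, (1 + (1 + ‖x‖) ^ (2 * P.p)) ^ 4 ∂P.μ₀) :=
    Real.one_le_sqrt.2 (one_le_integral_moment hΞ hμ₀ hp)
  have hF1 : constFrak1 P C ≤ P.η₁ / 2 := by
    unfold constFrak1
    rw [div_le_iff₀ (by positivity)]
    have h1 := min_le_left (constA P C) (constA P C ^ (1 / 3 : ℝ))
    have h2 := two_mul_constA_le_left (P := P) (C := C)
    nlinarith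
  have hL0 : 0 < constLtilde P C δ := by linarith
  have h1 : lam < constFrak1 P C / constLtilde P C δ ^ 2 := hlam.trans_le (min_le_left _ _)
  rw [lt_div_iff₀ (by positivity)] at h1
  rcases le_or_gt lam 0 with h0 | h0
  · nlinarith
  · have h2 : (P.η₁ + 1) ^ 2 ≤ constLtilde P C δ ^ 2 := pow_le_pow_left₀ (by linarith) hL 2
    have h3 : lam * (P.η₁ + 1) ^ 2 ≤ P.η₁ / 2 :=
      (mul_le_mul_of_nonneg_left h2 h0.le).trans (h1.le.trans hF1)
    have h4 : lam * P.η₁ * P.η₁ ≤ 1 / 2 * P.η₁ := by nlinarith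
    exact le_of_mul_le_mul_right h4 hη₁

theorem constB_lower (hη₁ : 0 < P.η₁) (hη₂ : 0 < P.η₂) (hgrad : P.GradientBounds C)
    (hι : IotaConsts C) :
    P.η₂ * C.bι + gradBound P C ^ 2 / constA P C ≤ constB P C := by
  have ha := constA_pos hη₁ hη₂ hι
  have hM := P.M_nonneg
  have h1 := hι.Mι_nonneg
  have hg := gradBound_nonneg hgrad
  have hmin : min P.η₁ (P.η₂ * C.aι) = 2 * constA P C := by unfold constA; ring
  have h2 : gradBound P C ≤ C.Kgrad * (1 + P.M) ^ C.ν + 2 ^ P.p * C.Mι * P.M ^ P.p :=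
    le_add_of_nonneg_right (by positivity)
  unfold constB
  rw [hmin, mul_div_mul_left _ _ two_ne_zero]
  gcongr

theorem constB_pos (hη₁ : 0 < P.η₁) (hη₂ : 0 < P.η₂) (hgrad : P.GradientBounds C)
    (hι : IotaConsts C) : 0 < constB P C := by
  have ha := constA_pos hη₁ hη₂ hι
  have hb := hι.2.2.2.2.1
  refine lt_of_lt_of_le ?_ (constB_lower hη₁ hη₂ hgrad hι)
  positivity

theorem two_mul_constB_add_le_constc1 (hη₁ : 0 < P.η₁) (hη₂ : 0 < P.η₂) (hι : IotaConsts C)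
    (δ β : ℝ) : 2 * constB P C + 2 * (d + 1) / β ≤ constc1 P C δ β := by
  have := lamMax_nonneg hη₁ hη₂ hι δ
  have hM1 : 0 ≤ constM1 P C := sq_nonneg _
  have : 0 ≤ 2 * constM1 P C * lamMax P C δ := by positivity
  unfold constc1
  linarith

theorem constc1_pos (hη₁ : 0 < P.η₁) (hη₂ : 0 < P.η₂) (hgrad : P.GradientBounds C)
    (hι : IotaConsts C) (δ : ℝ) {β : ℝ} (hβ : 0 < β) : 0 < constc1 P C δ β := by
  have := constB_pos hη₁ hη₂ hgrad hι
  exact lt_of_lt_of_le (by positivity) (two_mul_constB_add_le_constc1 hη₁ hη₂ hι δ β)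

/-- The moment constant absorbs the stationary part of the first absolute moment together with an
extra `1`. The latter comes from `b ≥ η₂ b_ι ≥ η₂ a_ι ≥ 2a`. -/
theorem one_add_stationary_le (hη₁ : 0 < P.η₁) (hη₂ : 0 < P.η₂) (hgrad : P.GradientBounds C)
    (hι : IotaConsts C) (hab : C.aι ≤ C.bι) (δ : ℝ) {β : ℝ} (hβ : 0 < β) :
    1 + gradBound P C / P.η₁ + Real.sqrt (4 / 3 * ((d + 1) / (β * P.η₁))) ≤
      Real.sqrt (constc1 P C δ β) * Real.sqrt (lamMax P C δ + (constA P C)⁻¹) := by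
  have ha := constA_pos hη₁ hη₂ hι
  have hc := constc1_pos hη₁ hη₂ hgrad hι δ hβ
  have hl := lamMax_nonneg hη₁ hη₂ hι δ
  have h2a := two_mul_constA_le_left (P := P) (C := C)
  rw [← Real.sqrt_mul hc.le]
  refine Real.le_sqrt_of_sq_le ?_
  set A := gradBound P C / P.η₁ with hA
  set W := 4 / 3 * (((d : ℝ) + 1) / (β * P.η₁)) with hWdef
  have hW : 0 ≤ W := by positivity
  have hWs := Real.sq_sqrt hW
  have hlow : 4 + 8 * A ^ 2 + 3 * W ≤ constc1 P C δ β * (constA P C)⁻¹ := by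
    rw [← div_eq_mul_inv, le_div_iff₀ ha]
    have h1 := two_mul_constB_add_le_constc1 hη₁ hη₂ hι δ β
    have h2 := constB_lower hη₁ hη₂ hgrad hι
    have h3 : 2 * constA P C ≤ P.η₂ * C.bι :=
      two_mul_constA_le_right.trans (mul_le_mul_of_nonneg_left hab hη₂.le)
    have h4 : 4 * A ^ 2 * constA P C ≤ gradBound P C ^ 2 / constA P C := by
      rw [le_div_iff₀ ha]
      have e : gradBound P C ^ 2 = A ^ 2 * P.η₁ ^ 2 := by rw [hA]; field_simp
      rw [e]
      have : (2 * constA P C) ^ 2 ≤ P.η₁ ^ 2 := pow_le_pow_left₀ (by linarith) h2a 2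
      nlinarith [mul_le_mul_of_nonneg_left this (sq_nonneg A)]
    have h5 : 3 * W * constA P C ≤ 2 * (d + 1) / β := by
      have e : 2 * ((d : ℝ) + 1) / β = 3 / 2 * W * P.η₁ := by rw [hWdef]; field_simp; ring
      rw [e]
      nlinarith
    linarith
  calc (1 + A + Real.sqrt W) ^ 2 ≤ 3 + 3 * A ^ 2 + 3 * Real.sqrt W ^ 2 := by
        nlinarith [sq_nonneg (1 - A), sq_nonneg (1 - Real.sqrt W), sq_nonneg (A - Real.sqrt W)]
    _ ≤ 4 + 8 * A ^ 2 + 3 * W := by rw [hWs]; nlinarith [sq_nonneg A]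
    _ ≤ constc1 P C δ β * (constA P C)⁻¹ := hlow
    _ ≤ _ := mul_le_mul_of_nonneg_left (le_add_of_nonneg_left hl) hc.le

theorem zero_lt_Ktilde (hgrad : P.GradientBounds C) : 0 < Ktilde P C := by
  have := hgrad.2.1
  exact lt_of_lt_of_le (by linarith) (le_max_left _ _)

theorem constFrak4_pos (hp : 1 ≤ P.p) (hη₂ : 0 < P.η₂) (hgrad : P.GradientBounds C)
    (hlip : P.LipschitzInData C) : 0 < constFrak4 P C := by
  have := P.M_nonneg
  have := hlip.1
  have := zero_lt_Ktilde hgrad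
  have := Real.sqrt_pos.2 hη₂
  unfold constFrak4
  positivity

theorem constC5_pos (hp : 1 ≤ P.p) (hη₁ : 0 < P.η₁) (hη₂ : 0 < P.η₂)
    (hgrad : P.GradientBounds C) (hlip : P.LipschitzInData C) (hι : IotaConsts C) (δ : ℝ) {β : ℝ}
    (hβ : 0 < β) : 0 < constC5 P C δ β := by
  have := constA_pos hη₁ hη₂ hι
  have := lamMax_nonneg hη₁ hη₂ hι δ
  exact mul_pos (mul_pos (constFrak4_pos hp hη₂ hgrad hlip)
    (Real.sqrt_pos.2 (constc1_pos hη₁ hη₂ hgrad hι δ hβ))) (Real.sqrt_pos.2 (by positivity))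

/-- The weight of the transport term in `C̃₄` and `ℭ₄`. -/
noncomputable def transportWeight (P : Problem d m) : ℝ :=
  4 * P.p / Real.sqrt P.η₂ * (1 + 4 * P.M) ^ (P.p - 1)

theorem transportWeight_nonneg (hp : 1 ≤ P.p) : 0 ≤ transportWeight P := by
  have := P.M_nonneg
  unfold transportWeight
  positivity

theorem transportWeight_le_constC4 (hp : 1 ≤ P.p) (hη₂ : 0 < P.η₂) (hgrad : P.GradientBounds C)
    (hlip : P.LipschitzInData C) : transportWeight P ≤ constC4 P C := by
  have hM := P.M_nonneg
  have hJ := hlip.1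
  have hK := zero_lt_Ktilde hgrad
  have h1 : transportWeight P ≤
      transportWeight P * (1 + 2 * Ktilde P C * (1 + P.M) ^ C.ν) :=
    le_mul_of_one_le_right (transportWeight_nonneg hp) (le_add_of_nonneg_right (by positivity))
  have h2 : 0 ≤ C.J * (1 + P.M) ^ C.χ := by positivity
  have h3 : 0 ≤ 2 ^ (P.p + 2) * P.p * P.M / P.η₂ * (1 + 4 * P.M) ^ (P.p - 1) := by positivity
  unfold constC4
  unfold transportWeight at *
  linarith

theorem constC4_pos (hp : 1 ≤ P.p) (hη₂ : 0 < P.η₂) (hgrad : P.GradientBounds C)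
    (hlip : P.LipschitzInData C) : 0 < constC4 P C := by
  have := P.M_nonneg
  have := Real.sqrt_pos.2 hη₂
  refine lt_of_lt_of_le ?_ (transportWeight_le_constC4 hp hη₂ hgrad hlip)
  unfold transportWeight
  positivity

theorem le_constFrak4 (hp : 1 ≤ P.p) (hgrad : P.GradientBounds C) :
    C.J * (1 + 2 * P.M) ^ C.χ + transportWeight P * (2 * growthBound P C) ≤ constFrak4 P C := by
  have hM := P.M_nonneg
  have hK := zero_lt_Ktilde hgrad
  have h1 : (1 + 4 * P.M) ^ ((C.ν : ℝ) + P.p - 1) =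
      (1 + 4 * P.M) ^ C.ν * (1 + 4 * P.M) ^ (P.p - 1) := by
    rw [add_sub_assoc, Real.rpow_add (by linarith), Real.rpow_natCast]
  have h2 : (1 + P.M) ^ C.ν ≤ (1 + 4 * P.M) ^ C.ν := by gcongr; linarith
  unfold constFrak4 transportWeight growthBound
  rw [h1]
  refine add_le_add_right ?_ _
  calc _ = 8 * P.p * Ktilde P C / Real.sqrt P.η₂ *
        ((1 + P.M) ^ C.ν * (1 + 4 * P.M) ^ (P.p - 1)) := by ring
    _ ≤ _ := by gcongr

theorem constC6_pos {Ω : Type*} [MeasurableSpace Ω] {Pr : Measure Ω}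
    {θ₀ : Ω → Euc (d + 1)} (hC4 : 0 < constFrak4 P C) (hθ₀ : MemLp θ₀ 2 Pr)
    (h : ¬ θ₀ =ᵐ[Pr] 0) : 0 < constC6 P C Pr θ₀ := by
  refine mul_pos hC4 (Real.sqrt_pos.2 ?_)
  refine lt_of_le_of_ne (integral_nonneg fun ω => by positivity) fun h0 => h ?_
  have h1 := (integral_eq_zero_iff_of_nonneg (fun ω => by positivity)
    (hθ₀.integrable_norm_pow two_ne_zero)).1 h0.symm
  filter_upwards [h1] with ω hω
  simpa using hω

end Constants

/-! ### Geometric decay of the initial value -/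

/-- From the first step on the contraction `(1 - λ η)ⁿ` beats `exp (-a λ (n + 1))`, since
`η ≥ 2a` and `2n ≥ n + 1`. -/
theorem one_sub_pow_le_exp {a η lam : ℝ} {n : ℕ} (ha : 0 ≤ a) (haη : 2 * a ≤ η) (hlam : 0 ≤ lam)
    (hlη : lam * η ≤ 1) (hn : 1 ≤ n) :
    (1 - lam * η) ^ n ≤ Real.exp (-(a * lam * (n + 1))) := by
  have hn' : (1 : ℝ) ≤ n := by exact_mod_cast hn
  calc (1 - lam * η) ^ n ≤ Real.exp (-(lam * η)) ^ n :=
        pow_le_pow_left₀ (by linarith) (Real.one_sub_le_exp_neg _) n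
    _ = Real.exp (n * -(lam * η)) := (Real.exp_nat_mul _ _).symm
    _ ≤ _ := by
        refine Real.exp_le_exp.2 ?_
        have h1 : a * lam * (n + 1) ≤ a * lam * (2 * n) := by gcongr; linarith
        have h2 : lam * (2 * a) * n ≤ lam * η * n := by gcongr
        linarith

/-! ### The expected discretisation error -/

theorem abs_integral_sub_le_of_linear_growth {Ω E : Type*} [MeasurableSpace Ω] {Pr : Measure Ω}
    [IsProbabilityMeasure Pr] [NormedAddCommGroup E] {f g : Ω → ℝ} {T : Ω → E} {c₀ c₁ : ℝ}
    (hf : Integrable f Pr) (hg : Integrable g Pr) (hT : Integrable T Pr)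
    (h : ∀ ω, |f ω - g ω| ≤ c₀ + c₁ * ‖T ω‖) :
    |∫ ω, f ω ∂Pr - ∫ ω, g ω ∂Pr| ≤ c₀ + c₁ * ∫ ω, ‖T ω‖ ∂Pr := by
  rw [← integral_sub hf hg]
  refine abs_integral_le_integral_abs.trans ?_
  refine (integral_mono (hf.sub hg).abs
    ((integrable_const c₀).add (hT.norm.const_mul c₁)) h).trans (le_of_eq ?_)
  simp only [Pi.add_apply]
  rw [integral_add (integrable_const _) (hT.norm.const_mul _), integral_const_mul]
  simp

end DRO

theorem mainTheorem5 {d m : ℕ} (hd : 1 ≤ d) (hm : 1 ≤ m)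
    -- the problem and the standing conventions
    (P : Problem d m) (C : Consts)
    (hΞ : IsCompact P.Ξ) (hμ₀ : P.μ₀ ∈ probOn P.Ξ)
    (hp : 1 ≤ P.p) (hη₁ : 0 < P.η₁) (hη₂ : 0 < P.η₂)
    (hreg : P.Regular) (hgrad : P.GradientBounds C) (hlip : P.LipschitzInData C)
    (hι : IotaConsts C) (hab : C.aι ≤ C.bι)
    (ℓ : ℕ) (hℓ : 1 ≤ ℓ) (hbox : P.Ξ ⊆ box m ℓ)
    -- the probability space, the data and the noise
    {Ω : Type*} [MeasurableSpace Ω] (Pr : Measure Ω) [IsProbabilityMeasure Pr]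
    (X : ℕ → Ω → Euc m) (hXm : ∀ n, Measurable (X n))
    (hXlaw : ∀ n, Pr.map (X n) = P.μ₀) (hXind : iIndepFun X Pr)
    (Z : ℕ → Ω → Euc (d + 1)) (hZm : ∀ n, Measurable (Z n))
    (hZlaw : ∀ n, Pr.map (Z n) = stdGaussian (Euc (d + 1))) (hZind : iIndepFun Z Pr)
    (hXZ : IndepFun (fun ω n => X n ω) (fun ω n => Z n ω) Pr)
    (θ₀ : Ω → Euc (d + 1)) (hθ₀ : MemLp θ₀ 4 Pr)
    (β δ : ℝ) (hβ : 0 < β) (hδ : 0 < δ) :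
    0 < constC4 P C ∧ 0 < constC5 P C δ β ∧ 0 ≤ constC6 P C Pr θ₀ ∧
    (¬ (θ₀ =ᵐ[Pr] 0) → 0 < constC6 P C Pr θ₀) ∧
    ∀ j : ℕ, 1 ≤ j →
      -- rounding to the grid of mesh `2⁻ʲ` stays inside the data space
      (∀ y ∈ P.Ξ, dyadicFloor j y ∈ P.Ξ) →
      -- any enumeration of the grid points of the data space
      ∀ (N : ℕ) (ξ : Fin N → Euc m), Set.range ξ = P.Ξ ∩ dyadicGrid m ℓ j →
      ∀ lam : ℝ, 0 < lam → lam < lamMax P C δ →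
      ∀ n : ℕ, 1 ≤ n →
        Integrable (fun ω => P.u (thetaPart (sgld P δ β lam ξ θ₀ X Z n ω))) Pr ∧
        Integrable (fun ω => P.uGrid ℓ j (thetaPart (sgld P δ β lam ξ θ₀ X Z n ω))) Pr ∧
        |(∫ ω, P.u (thetaPart (sgld P δ β lam ξ θ₀ X Z n ω)) ∂Pr)
            - ∫ ω, P.uGrid ℓ j (thetaPart (sgld P δ β lam ξ θ₀ X Z n ω)) ∂Pr|
          ≤ Real.sqrt m *
              (constC4 P C + constC5 P C δ β
                + constC6 P C Pr θ₀ * Real.exp (-(constA P C * lam * (n + 1)))) / 2 ^ j := by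
  have hθ₀' : MemLp θ₀ 2 Pr := hθ₀.mono_exponent (by norm_num)
  have hF4 := constFrak4_pos hp hη₂ hgrad hlip
  refine ⟨constC4_pos hp hη₂ hgrad hlip, constC5_pos hp hη₁ hη₂ hgrad hlip hι δ hβ,
    mul_nonneg hF4.le (Real.sqrt_nonneg _), constC6_pos hF4 hθ₀', ?_⟩
  intro j _ hj N ξ hξ lam hlam hlamMax n hn
  have hξΞ : ∀ k, ξ k ∈ P.Ξ := fun k => (hξ.subset (Set.mem_range_self k)).1
  have hlη := mul_le_half_of_lt_lamMax hΞ hμ₀ hp hη₁ hη₂ hgrad hι hδ hlamMax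
  obtain ⟨hT, hE⟩ := memLp_thetaPart_sgld_and_integral_norm_le (δ := δ) hΞ hη₁ hreg hgrad hξΞ hXm
    hZm hZlaw hZind hθ₀' hβ hlam.le hlη n
  have hu := integrable_robustObjective_comp hΞ hp hη₂ hreg hgrad subset_rfl hμ₀ hT
  have hg := integrable_robustObjective_comp hΞ hp hη₂ hreg hgrad Set.inter_subset_left
    (gridMeasure_mem_probOn hΞ hℓ hbox hj hμ₀) hT
  refine ⟨hu, hg, ?_⟩
  have hw := transportWeight_nonneg hp
  have hε : 0 ≤ Real.sqrt m / 2 ^ j := by positivity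
  have hpoint : ∀ θ, |P.u θ - P.uGrid ℓ j θ| ≤
      Real.sqrt m / 2 ^ j * (transportWeight P + constFrak4 P C)
        + Real.sqrt m / 2 ^ j * constFrak4 P C * ‖θ‖ := fun θ => by
    have h1 : (C.J * (1 + 2 * P.M) ^ C.χ + transportWeight P * (2 * growthBound P C)) * (1 + ‖θ‖) ≤
        constFrak4 P C * (1 + ‖θ‖) :=
      mul_le_mul_of_nonneg_right (le_constFrak4 hp hgrad) (by positivity)
    calc _ ≤ Real.sqrt m / 2 ^ j * (C.J * (1 + 2 * P.M) ^ C.χ * (1 + ‖θ‖) +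
          transportWeight P * (1 + 2 * (growthBound P C * (1 + ‖θ‖)))) :=
          abs_u_sub_uGrid_le hΞ hμ₀ hp hη₂ hreg hgrad hlip hℓ hbox hj θ
      _ ≤ Real.sqrt m / 2 ^ j * (transportWeight P + constFrak4 P C * (1 + ‖θ‖)) :=
          mul_le_mul_of_nonneg_left (by linarith) hε
      _ = _ := by ring
  have hdecay := one_sub_pow_le_exp (constA_pos hη₁ hη₂ hι).le two_mul_constA_le_left hlam.le
    (by linarith : lam * P.η₁ ≤ 1) hn
  have hstat := one_add_stationary_le hη₁ hη₂ hgrad hι hab δ hβ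
  have hinit := mul_le_mul_of_nonneg_right hdecay (Real.sqrt_nonneg (∫ ω, ‖θ₀ ω‖ ^ 2 ∂Pr))
  have hmoment := mul_le_mul_of_nonneg_left (add_le_add hstat hinit) hF4.le
  have hE' := mul_le_mul_of_nonneg_left hE hF4.le
  have hC4 := transportWeight_le_constC4 hp hη₂ hgrad hlip
  refine (abs_integral_sub_le_of_linear_growth hu hg (hT.integrable one_le_two)
    fun ω => hpoint _).trans ?_
  rw [mul_assoc, ← mul_add, mul_div_right_comm]
  refine mul_le_mul_of_nonneg_left ?_ hε
  unfold constC5 constC6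
  linarith
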